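/- For a finite graded poset $P$ of rank $n+1$ and $S\subseteq[n]=\{1,\dots,n\}$, let $f_S$ be the number of chains of $P$ whose set of ranks is exactly $S$, let $h_S=\sum_{T\subseteq S}(-1)^{|S\setminus T|}f_T$, and let $u_S=u_1\cdots u_n$ be the monomial in non-commuting variables $\mathbf a,\mathbf b$ with $u_i=\mathbf b$ if $i\in S$ and $u_i=\mathbf a$ if $i\notin S$. The $\mathbf{ab}$-index of $P$ is $\sum_{S\subseteq[n]}h_Su_S$; when it can be written as a polynomial in $\mathbf c=\mathbf a+\mathbf b$ and $\mathbf d=\mathbf{ab}+\mathbf{ba}$ (as it can for every Eulerian poset), this polynomial is unique and is called the $\mathbf{cd}$-index $\Psi(P)$. Let $B_{n+1}$ be the lattice of all subsets of an $(n+1)$-element set. For a $\mathbf{cd}$-monomial $v$ of degree $n$ (where $\deg\mathbf c=1$, $\deg\mathbf d=2$), let $\beta(v)$ be the coefficient of $v$ in $\Psi(B_{n+1})$. Write a list $(m_1,\dots,m_k)$ of non-negative integers for the monomial $\mathbf c^{m_1}\mathbf d\,\mathbf c^{m_2}\mathbf d\cdots\mathbf d\,\mathbf c^{m_k}$, and $0^s$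 for a block of $s$ zero entries. **Proposition.** Let $t\in\{1,2\}$ and let $n\ge 0$. The sequence $s_i=\beta(0^i,t,0^{n-i})$, $0\le i\le n$, is reverse unimodal in $i$. More precisely, $$s_0>s_1>\dots>s_{\lfloor n/2\rfloor}=s_{\lceil n/2\rceil}<\dots<s_{n-1}<s_n,$$ and if $i,j,l,m$ are non-negative integers with $i+j=l+m=n$ and $|i-j|>|l-m|$, then $$\beta(0^i,t,0^j)>\beta(0^l,t,0^m).$$ -/

import Mathlib

/-- The two non-commuting variables `a`, `b` of the **ab**-index. -/
inductive ABVar : Type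
  | a : ABVar
  | b : ABVar

/-- The two non-commuting variables `c` (degree 1), `d` (degree 2) of the **cd**-index. -/
inductive CDVar : Type
  | c : CDVar
  | d : CDVar

/-- The flag `f`-vector of a finite graded poset `P`: the number of chains of `P` whose elements
occupy exactly the ranks in `S` (one element on each rank in `S`). -/
noncomputable def flagF (P : Type*) [PartialOrder P] [GradeMinOrder ℕ P] [Fintype P]
    (S : Finset ℕ) : ℕ :=
  {C : Finset P | IsChain (· ≤ ·) (C : Set P) ∧ C.image (grade ℕ) = S}.ncard

/-- The flag `h`-vector, `h_S = ∑_{T ⊆ S} (-1)^{|S - T|} f_T`. -/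
noncomputable def flagH (P : Type*) [PartialOrder P] [GradeMinOrder ℕ P] [Fintype P]
    (S : Finset ℕ) : ℤ :=
  ∑ T ∈ S.powerset, (-1) ^ (S \ T).card * (flagF P T : ℤ)

/-- The monomial `u_S = u_1 u_2 ⋯ u_n`, with `u_i = b` if `i ∈ S` and `u_i = a` otherwise. -/
noncomputable def abMonomial (n : ℕ) (S : Finset ℕ) : FreeAlgebra ℚ ABVar :=
  ((List.range n).map fun i => FreeAlgebra.ι ℚ (if i + 1 ∈ S then ABVar.b else ABVar.a)).prod

/-- The **ab**-index `∑_{S ⊆ [n]} h_S u_S` of a finite graded poset `P` of rank `n + 1`. -/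
noncomputable def abIndex (P : Type*) [PartialOrder P] [GradeMinOrder ℕ P] [Fintype P] (n : ℕ) :
    FreeAlgebra ℚ ABVar :=
  ∑ S ∈ (Finset.Icc 1 n).powerset, (flagH P S : ℚ) • abMonomial n S

/-- The substitution `c = a + b`, `d = ab + ba`. -/
noncomputable def cdToAb : FreeAlgebra ℚ CDVar →ₐ[ℚ] FreeAlgebra ℚ ABVar :=
  FreeAlgebra.lift ℚ fun x =>
    match x with
    | .c => FreeAlgebra.ι ℚ ABVar.a + FreeAlgebra.ι ℚ ABVar.b
    | .d => FreeAlgebra.ι ℚ ABVar.a * FreeAlgebra.ι ℚ ABVar.b +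
        FreeAlgebra.ι ℚ ABVar.b * FreeAlgebra.ι ℚ ABVar.a

open Classical in
/-- The **cd**-index of a finite graded poset `P` of rank `n + 1`: the polynomial in `c`, `d` which
becomes the **ab**-index of `P` under `c = a + b`, `d = ab + ba` (and `0` if there is none). -/
noncomputable def cdIndex (P : Type*) [PartialOrder P] [GradeMinOrder ℕ P] [Fintype P] (n : ℕ) :
    FreeAlgebra ℚ CDVar :=
  if h : ∃ Φ : FreeAlgebra ℚ CDVar, cdToAb Φ = abIndex P n then h.choose else 0

/-- The coefficient of a **cd**-monomial in a polynomial in `c`, `d`. -/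
noncomputable def cdCoeff (Φ : FreeAlgebra ℚ CDVar) (w : FreeMonoid CDVar) : ℚ :=
  (FreeAlgebra.equivMonoidAlgebraFreeMonoid Φ).coeff w

/-- The degree of a **cd**-monomial, where `c` has degree 1 and `d` has degree 2. -/
def cdDegree (w : FreeMonoid CDVar) : ℕ :=
  (w.toList.map fun x =>
    match x with
    | .c => 1
    | .d => 2).sum

/-- The Boolean lattice of all subsets of an `m`-element set, ordered by inclusion and graded by
cardinality. -/
abbrev BooleanLattice (m : ℕ) : Type := Finset (Fin m)

/-- `β(v)` for a **cd**-monomial `v` of degree `n`: the coefficient of `v` in the **cd**-index of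
the Boolean lattice of rank `n + 1`. -/
noncomputable def betaMonomial (v : FreeMonoid CDVar) : ℚ :=
  cdCoeff (cdIndex (BooleanLattice (cdDegree v + 1)) (cdDegree v)) v

/-- The **cd**-monomial `c^{m₁} d c^{m₂} d ⋯ d c^{m_k}` of the nonempty list with first entry `m₁`
and remaining entries `(m₂, …, m_k)`. -/
def cdMonomial : ℕ → List ℕ → FreeMonoid CDVar
  | m, [] => FreeMonoid.of CDVar.c ^ m
  | m, m' :: L => FreeMonoid.of CDVar.c ^ m * FreeMonoid.of CDVar.d * cdMonomial m' L

/-- `β` in list notation. The empty list stands for the formal symbol `e` of degree `-1`, which is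
the **cd**-index of the Boolean lattice of rank `0`, so its value is `1`. -/
noncomputable def betaList : List ℕ → ℚ
  | [] => 1
  | m :: L => betaMonomial (cdMonomial m L)

/-- The list `(0^i, t, 0^j)`. -/
def zeroList (i t j : ℕ) : List ℕ :=
  List.replicate i 0 ++ t :: List.replicate j 0

/-! Divide `β(v)` by `(deg v + 1)!`. Splitting a chain of subsets at its largest element shows that
the exponential generating function `F` of the ab-indices of the Boolean lattices satisfies `F = G +
F b G` with `G = (exp((a - b)x) - 1)/(a - b)`. Differentiating gives the Riccati equation `2F' = 2 +
cF + Fc + F d F`. Its coefficient recursion only involves `c` and `d`, so it can be solved among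
cd-polynomials (`booleanCD`); as the substitution into `a`, `b` is injective, the solution is the
cd-index up to the factorial (`cdIndex_booleanLattice`).

Let `γ_k` be the normalized coefficient of `d^k`. The recursion yields the closed forms `γ_i γ_j /
2` for `d^i c d^j` and `γ_i γ_j / 4 - γ_{i+j+1} / 2` for `d^i c c d^j` (`gammaWord_d_c_d`,
`gammaWord_d_c_c_d`). For fixed `i + j` both are increasing functions of `γ_i γ_j`, so all the
claims follow from strict log-convexity of `γ` together with the symmetry in `i`, `j`.

Log-convexity comes from writing `γ_k = μ_k / 2^k` with `μ_k = ∫ T^k 1` over the unit interval,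
where `T` inverts `-d²/dx²` with mixed boundary conditions. The quadratic recursion for `μ` is
conservation of energy for `-v'' = z v` (`greenMoment_succ`), and `T` is self-adjoint and positive,
so the Cauchy–Schwarz inequality applies; it is strict because consecutive iterates are not
proportional (`greenMoment_sq_lt`). -/

/-! ### Coefficients of words in a free algebra -/

/-- The coefficient of a word in an element of a free algebra. -/
noncomputable def wordCoeff {X : Type*} : FreeAlgebra ℚ X →ₗ[ℚ] (List X → ℚ) where
  toFun p l := (FreeAlgebra.equivMonoidAlgebraFreeMonoid p).coeff (FreeMonoid.ofList l)
  map_add' p q := by ext l; simp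
  map_smul' r p := by ext l; simp

theorem cdCoeff_eq_wordCoeff (Φ : FreeAlgebra ℚ CDVar) (w : FreeMonoid CDVar) :
    cdCoeff Φ w = wordCoeff Φ w.toList := rfl

section WordCoeff

variable {X : Type*}

theorem equivMonoidAlgebraFreeMonoid_ι (x : X) :
    FreeAlgebra.equivMonoidAlgebraFreeMonoid (FreeAlgebra.ι ℚ x) =
      MonoidAlgebra.single (FreeMonoid.of x) (1 : ℚ) := by
  simp [FreeAlgebra.equivMonoidAlgebraFreeMonoid]

theorem wordCoeff_ι_mul_nil (x : X) (p : FreeAlgebra ℚ X) :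
    wordCoeff (FreeAlgebra.ι ℚ x * p) [] = 0 := by
  simp only [wordCoeff, LinearMap.coe_mk, AddHom.coe_mk, map_mul, equivMonoidAlgebraFreeMonoid_ι]
  apply MonoidAlgebra.coeff_single_mul_of_forall_mul_ne
  intro d h
  exact List.cons_ne_nil _ _ (congrArg FreeMonoid.toList h)

theorem wordCoeff_ι_mul_cons [DecidableEq X] (x y : X) (p : FreeAlgebra ℚ X) (l : List X) :
    wordCoeff (FreeAlgebra.ι ℚ x * p) (y :: l) = if x = y then wordCoeff p l else 0 := by
  simp only [wordCoeff, LinearMap.coe_mk, AddHom.coe_mk, map_mul, equivMonoidAlgebraFreeMonoid_ι]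
  split_ifs with h
  · subst h
    rw [MonoidAlgebra.coeff_single_mul_eq_mul_coeff (FreeMonoid.ofList l), one_mul]
    intro m' _
    constructor
    · intro h
      exact (List.cons.inj (congrArg FreeMonoid.toList h)).2
    · rintro rfl
      rfl
  · apply MonoidAlgebra.coeff_single_mul_of_forall_mul_ne
    intro d h'
    exact h (List.cons.inj (congrArg FreeMonoid.toList h')).1

theorem wordCoeff_mul_ι_nil (x : X) (p : FreeAlgebra ℚ X) :
    wordCoeff (p * FreeAlgebra.ι ℚ x) [] = 0 := by
  simp only [wordCoeff, LinearMap.coe_mk, AddHom.coe_mk, map_mul, equivMonoidAlgebraFreeMonoid_ι]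
  apply MonoidAlgebra.coeff_mul_single_of_forall_mul_ne
  intro d h
  exact List.append_ne_nil_of_right_ne_nil _ (List.cons_ne_nil _ _)
    (congrArg FreeMonoid.toList h)

theorem wordCoeff_mul_ι_concat [DecidableEq X] (x y : X) (p : FreeAlgebra ℚ X) (l : List X) :
    wordCoeff (p * FreeAlgebra.ι ℚ x) (l ++ [y]) = if x = y then wordCoeff p l else 0 := by
  simp only [wordCoeff, LinearMap.coe_mk, AddHom.coe_mk, map_mul, equivMonoidAlgebraFreeMonoid_ι]
  have key : ∀ d : FreeMonoid X, d * FreeMonoid.of x = FreeMonoid.ofList (l ++ [y]) ↔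
      d = FreeMonoid.ofList l ∧ x = y := by
    intro d
    constructor
    · intro h
      have h' : d.toList ++ [x] = l ++ [y] := congrArg FreeMonoid.toList h
      have := List.append_inj' h' rfl
      exact ⟨this.1, by simpa using this.2⟩
    · rintro ⟨rfl, rfl⟩
      rfl
  split_ifs with h
  · rw [MonoidAlgebra.coeff_mul_single_eq_coeff_mul (FreeMonoid.ofList l), mul_one]
    intro m' _
    rw [key]
    simp [h]
  · apply MonoidAlgebra.coeff_mul_single_of_forall_mul_ne
    intro d h'
    exact h ((key d).1 h').2

theorem wordCoeff_one_nil : wordCoeff (1 : FreeAlgebra ℚ X) [] = 1 := by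
  simp only [wordCoeff, LinearMap.coe_mk, AddHom.coe_mk, map_one]
  exact MonoidAlgebra.coeff_one_one

theorem wordCoeff_one_cons (x : X) (l : List X) :
    wordCoeff (1 : FreeAlgebra ℚ X) (x :: l) = 0 := by
  classical
  simp only [wordCoeff, LinearMap.coe_mk, AddHom.coe_mk, map_one, MonoidAlgebra.one_def]
  rw [MonoidAlgebra.coeff_single, Finsupp.single_apply, if_neg]
  intro h
  exact List.cons_ne_nil _ _ (congrArg FreeMonoid.toList h).symm

theorem wordCoeff_injective {p q : FreeAlgebra ℚ X} (h : wordCoeff p = wordCoeff q) : p = q := by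
  apply FreeAlgebra.equivMonoidAlgebraFreeMonoid.injective
  apply MonoidAlgebra.coeff_injective
  ext w
  exact congrFun h w.toList

theorem exists_eq_smul_one_add_sum_ι_mul [Fintype X] (p : FreeAlgebra ℚ X) :
    ∃ (k : ℚ) (f : X → FreeAlgebra ℚ X), p = k • 1 + ∑ x, FreeAlgebra.ι ℚ x * f x := by
  classical
  induction p using FreeAlgebra.induction with
  | grade0 r => exact ⟨r, 0, by simp [Algebra.algebraMap_eq_smul_one]⟩
  | grade1 x =>
    exact ⟨0, Pi.single x 1, by simp [Pi.single_apply]⟩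
  | mul p q hp hq =>
    obtain ⟨k, f, rfl⟩ := hp
    obtain ⟨m, g, rfl⟩ := hq
    refine ⟨k * m, fun x => f x * (m • 1 + ∑ x, FreeAlgebra.ι ℚ x * g x) + k • g x, ?_⟩
    rw [add_mul, Finset.sum_mul]
    simp only [mul_add _ (f _ * _), ← mul_assoc, Finset.sum_add_distrib]
    simp only [smul_mul_assoc, one_mul, smul_add, smul_smul, Finset.smul_sum, mul_smul_comm]
    abel
  | add p q hp hq =>
    obtain ⟨k, f, rfl⟩ := hp
    obtain ⟨m, g, rfl⟩ := hq
    refine ⟨k + m, f + g, ?_⟩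
    simp only [add_smul, Pi.add_apply, mul_add, Finset.sum_add_distrib]
    abel

end WordCoeff

/-! ### Injectivity of the substitution `c = a + b`, `d = ab + ba` -/

open Classical in
noncomputable instance : Fintype CDVar := ⟨{.c, .d}, fun x => by cases x <;> simp⟩

open Classical in
noncomputable instance : Fintype ABVar := ⟨{.a, .b}, fun x => by cases x <;> simp⟩

theorem CDVar.exists_decomposition (p : FreeAlgebra ℚ CDVar) :
    ∃ (k : ℚ) (p₁ p₂ : FreeAlgebra ℚ CDVar),
      p = k • 1 + (FreeAlgebra.ι ℚ CDVar.c * p₁ + FreeAlgebra.ι ℚ CDVar.d * p₂) := by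
  classical
  obtain ⟨k, f, h⟩ := exists_eq_smul_one_add_sum_ι_mul p
  refine ⟨k, f .c, f .d, h.trans ?_⟩
  congr 1
  change ∑ x ∈ {CDVar.c, CDVar.d}, _ = _
  rw [Finset.sum_pair (by simp)]

theorem ABVar.eq_zero_of_decomposition_eq_zero {k : ℚ} {p q : FreeAlgebra ℚ ABVar}
    (h : k • 1 + (FreeAlgebra.ι ℚ ABVar.a * p + FreeAlgebra.ι ℚ ABVar.b * q) = 0) :
    k = 0 ∧ p = 0 ∧ q = 0 := by
  classical
  have h' : ∀ l, wordCoeff (k • 1 + (FreeAlgebra.ι ℚ ABVar.a * p + FreeAlgebra.ι ℚ ABVar.b * q)) l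
      = 0 := fun l => by rw [h, map_zero]; rfl
  simp only [map_add, map_smul, Pi.add_apply, Pi.smul_apply] at h'
  refine ⟨?_, wordCoeff_injective ?_, wordCoeff_injective ?_⟩
  · simpa [wordCoeff_one_nil, wordCoeff_ι_mul_nil] using h' []
  · ext l
    simpa [wordCoeff_one_cons, wordCoeff_ι_mul_cons] using h' (.a :: l)
  · ext l
    simpa [wordCoeff_one_cons, wordCoeff_ι_mul_cons] using h' (.b :: l)

theorem cdToAb_c : cdToAb (FreeAlgebra.ι ℚ CDVar.c) =
    FreeAlgebra.ι ℚ ABVar.a + FreeAlgebra.ι ℚ ABVar.b := by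
  simp [cdToAb]

theorem cdToAb_d : cdToAb (FreeAlgebra.ι ℚ CDVar.d) =
    FreeAlgebra.ι ℚ ABVar.a * FreeAlgebra.ι ℚ ABVar.b +
      FreeAlgebra.ι ℚ ABVar.b * FreeAlgebra.ι ℚ ABVar.a := by
  simp [cdToAb]

/-- Write `p = k + c p₁ + d p₂` and let `φ` be the substitution. The image is `k + a(φp₁ + b φp₂) +
b(φp₁ + a φp₂)`, so `k = 0` and both brackets vanish. Their difference `(b - a) φp₂` is then zero,
which forces `φp₂ = 0` and `φp₁ = 0`, and the first letter can be stripped from the word. -/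
theorem wordCoeff_eq_zero_of_cdToAb_eq_zero (l : List CDVar) :
    ∀ p, cdToAb p = 0 → wordCoeff p l = 0 := by
  classical
  induction l with
  | nil =>
    intro p hp
    obtain ⟨k, p₁, p₂, rfl⟩ := CDVar.exists_decomposition p
    have h : k • 1 + (FreeAlgebra.ι ℚ ABVar.a * (cdToAb p₁ + FreeAlgebra.ι ℚ ABVar.b * cdToAb p₂) +
        FreeAlgebra.ι ℚ ABVar.b * (cdToAb p₁ + FreeAlgebra.ι ℚ ABVar.a * cdToAb p₂)) = 0 := by
      rw [← hp]
      simp only [map_add, map_mul, map_smul, map_one, cdToAb_c, cdToAb_d]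
      noncomm_ring
    obtain ⟨rfl, -, -⟩ := ABVar.eq_zero_of_decomposition_eq_zero h
    simp [wordCoeff_ι_mul_nil]
  | cons x l ih =>
    intro p hp
    obtain ⟨k, p₁, p₂, rfl⟩ := CDVar.exists_decomposition p
    have h : k • 1 + (FreeAlgebra.ι ℚ ABVar.a * (cdToAb p₁ + FreeAlgebra.ι ℚ ABVar.b * cdToAb p₂) +
        FreeAlgebra.ι ℚ ABVar.b * (cdToAb p₁ + FreeAlgebra.ι ℚ ABVar.a * cdToAb p₂)) = 0 := by
      rw [← hp]
      simp only [map_add, map_mul, map_smul, map_one, cdToAb_c, cdToAb_d]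
      noncomm_ring
    obtain ⟨-, h₁, h₂⟩ := ABVar.eq_zero_of_decomposition_eq_zero h
    have h₃ : (0 : ℚ) • 1 + (FreeAlgebra.ι ℚ ABVar.a * (- cdToAb p₂) +
        FreeAlgebra.ι ℚ ABVar.b * cdToAb p₂) = 0 := by
      rw [← sub_self (0 : FreeAlgebra ℚ ABVar)]
      nth_rewrite 1 [← h₁]
      rw [← h₂, zero_smul]
      noncomm_ring
    have h₄ := (ABVar.eq_zero_of_decomposition_eq_zero h₃).2.2
    have h₅ : cdToAb p₁ = 0 := by simpa [h₄] using h₁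
    cases x <;> simp [wordCoeff_one_cons, wordCoeff_ι_mul_cons, ih _ h₄, ih _ h₅]

theorem cdToAb_injective : Function.Injective cdToAb := by
  rw [injective_iff_map_eq_zero]
  intro p hp
  apply wordCoeff_injective
  ext l
  rw [wordCoeff_eq_zero_of_cdToAb_eq_zero l p hp, map_zero]
  rfl

theorem cdIndex_eq_of_cdToAb_eq {P : Type*} [PartialOrder P] [GradeMinOrder ℕ P] [Fintype P]
    {n : ℕ} {Φ : FreeAlgebra ℚ CDVar} (h : cdToAb Φ = abIndex P n) : cdIndex P n = Φ := by
  have hex : ∃ Φ : FreeAlgebra ℚ CDVar, cdToAb Φ = abIndex P n := ⟨Φ, h⟩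
  rw [cdIndex, dif_pos hex]
  exact cdToAb_injective (hex.choose_spec.trans h.symm)

/-! ### Moments of the Green operator on the unit interval -/

/-- The iterates of the constant function `1` under the inverse of `-d²/dx²` with boundary
conditions `u'(0) = 0` and `u(1) = 0`. -/
noncomputable def greenIterate : ℕ → ℝ → ℝ
  | 0 => fun _ => 1
  | k + 1 => fun x => ∫ s in x..1, ∫ r in (0 : ℝ)..s, greenIterate k r

/-- The primitive of `greenIterate k` vanishing at `0`. -/
noncomputable def greenPrimitive (k : ℕ) (x : ℝ) : ℝ := ∫ r in (0 : ℝ)..x, greenIterate k r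

/-- The integral of `greenIterate k` over the unit interval. -/
noncomputable def greenMoment (k : ℕ) : ℝ := greenPrimitive k 1

theorem greenIterate_succ_eq (k : ℕ) :
    greenIterate (k + 1) = fun x => -∫ s in (1 : ℝ)..x, greenPrimitive k s := by
  funext x
  rw [← intervalIntegral.integral_symm]
  rfl

theorem hasDerivAt_greenPrimitive_of_continuous {k : ℕ} (h : Continuous (greenIterate k)) (x : ℝ) :
    HasDerivAt (greenPrimitive k) (greenIterate k x) x :=
  (h.integral_hasStrictDerivAt 0 x).hasDerivAt

theorem continuous_greenIterate (k : ℕ) : Continuous (greenIterate k) := by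
  induction k with
  | zero => exact continuous_const
  | succ k ih =>
    have hw : Continuous (greenPrimitive k) := continuous_iff_continuousAt.2 fun x =>
      (hasDerivAt_greenPrimitive_of_continuous ih x).continuousAt
    rw [greenIterate_succ_eq]
    exact continuous_iff_continuousAt.2 fun x =>
      (hw.integral_hasStrictDerivAt 1 x).hasDerivAt.neg.continuousAt

theorem hasDerivAt_greenPrimitive (k : ℕ) (x : ℝ) :
    HasDerivAt (greenPrimitive k) (greenIterate k x) x :=
  hasDerivAt_greenPrimitive_of_continuous (continuous_greenIterate k) x

theorem continuous_greenPrimitive (k : ℕ) : Continuous (greenPrimitive k) :=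
  continuous_iff_continuousAt.2 fun x => (hasDerivAt_greenPrimitive k x).continuousAt

theorem hasDerivAt_greenIterate_succ (k : ℕ) (x : ℝ) :
    HasDerivAt (greenIterate (k + 1)) (-greenPrimitive k x) x := by
  rw [greenIterate_succ_eq]
  exact ((continuous_greenPrimitive k).integral_hasStrictDerivAt 1 x).hasDerivAt.neg

theorem greenPrimitive_zero_right (k : ℕ) : greenPrimitive k 0 = 0 := by
  simp [greenPrimitive]

theorem greenIterate_succ_one (k : ℕ) : greenIterate (k + 1) 1 = 0 := by
  simp [greenIterate]

theorem greenPrimitive_zero (x : ℝ) : greenPrimitive 0 x = x := by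
  simp [greenPrimitive, greenIterate]

/-- Integration by parts: the boundary terms vanish because the primitive is zero at `0` and the
later iterates are zero at `1`. -/
theorem integral_greenIterate_mul_succ (i j : ℕ) :
    ∫ x in (0 : ℝ)..1, greenIterate i x * greenIterate (j + 1) x =
      ∫ x in (0 : ℝ)..1, greenPrimitive i x * greenPrimitive j x := by
  have h := intervalIntegral.integral_mul_deriv_eq_deriv_mul (a := 0) (b := 1)
    (fun x _ => hasDerivAt_greenPrimitive i x) (fun x _ => hasDerivAt_greenIterate_succ j x)
    ((continuous_greenIterate i).intervalIntegrable 0 1)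
    ((continuous_greenPrimitive j).neg.intervalIntegrable 0 1)
  rw [greenIterate_succ_one, greenPrimitive_zero_right] at h
  simp only [mul_neg, intervalIntegral.integral_neg] at h
  linarith

/-- Self-adjointness of the Green operator: integrating by parts twice moves one application from
one factor to the other. -/
theorem integral_greenIterate_mul (i j : ℕ) :
    ∫ x in (0 : ℝ)..1, greenIterate i x * greenIterate j x = greenMoment (i + j) := by
  induction i generalizing j with
  | zero => simp [greenMoment, greenPrimitive, greenIterate]
  | succ i ih =>
    rw [Nat.succ_add_eq_add_succ, ← ih (j + 1), integral_greenIterate_mul_succ]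
    simp only [mul_comm (greenIterate (i + 1) _), mul_comm (greenPrimitive i _)]
    exact integral_greenIterate_mul_succ j i

theorem integral_greenPrimitive_mul (i j : ℕ) :
    ∫ x in (0 : ℝ)..1, greenPrimitive i x * greenPrimitive j x = greenMoment (i + j + 1) := by
  rw [← integral_greenIterate_mul_succ, integral_greenIterate_mul, add_assoc]

/-- The coefficients of the conserved energy of `-v'' = w v`. -/
noncomputable def greenEnergy (k : ℕ) (x : ℝ) : ℝ :=
  ∑ p ∈ Finset.HasAntidiagonal.antidiagonal (k + 1), greenIterate p.1 x * greenIterate p.2 x +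
    ∑ p ∈ Finset.HasAntidiagonal.antidiagonal k, greenPrimitive p.1 x * greenPrimitive p.2 x

/-- With generating functions `v = ∑ z^k v_k` of the iterates and `w = ∑ z^k w_k` of the primitives,
`v' = -z w` and `w' = v`. Hence `v² + z w²` is constant, and `greenEnergy k` is its coefficient of
`z^(k+1)`. -/
theorem hasDerivAt_greenEnergy (k : ℕ) (x : ℝ) : HasDerivAt (greenEnergy k) 0 x := by
  have hv : ∀ i, HasDerivAt (greenIterate i) (match i with
      | 0 => 0
      | i + 1 => -greenPrimitive i x) x := by
    rintro (_ | i)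
    · exact hasDerivAt_const x 1
    · exact hasDerivAt_greenIterate_succ i x
  have h := (HasDerivAt.fun_sum fun p (_ : p ∈ Finset.HasAntidiagonal.antidiagonal (k + 1)) =>
    (hv p.1).mul (hv p.2)).add (HasDerivAt.fun_sum fun p (_ : p ∈ Finset.HasAntidiagonal.antidiagonal k) =>
      (hasDerivAt_greenPrimitive p.1 x).mul (hasDerivAt_greenPrimitive p.2 x))
  refine HasDerivAt.congr_deriv (f := greenEnergy k) h ?_
  rw [Finset.sum_add_distrib, Finset.Nat.sum_antidiagonal_succ, Finset.Nat.sum_antidiagonal_succ',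
    Finset.sum_add_distrib]
  simp only [neg_mul, mul_neg, Finset.sum_neg_distrib]
  ring

theorem greenEnergy_eq (k : ℕ) (x : ℝ) :
    greenEnergy k x = ∑ p ∈ Finset.HasAntidiagonal.antidiagonal k, greenMoment p.1 * greenMoment p.2 := by
  have h := is_const_of_deriv_eq_zero (fun x => (hasDerivAt_greenEnergy k x).differentiableAt)
    (fun x => (hasDerivAt_greenEnergy k x).deriv) x 1
  -- At `x = 1` each product of iterates has an index that is at least `1`, hence a vanishing
  -- factor; only the primitives contribute.
  rw [h, greenEnergy, Finset.sum_eq_zero, zero_add]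
  · rfl
  · rintro ⟨i, j⟩ hp
    rw [Finset.HasAntidiagonal.mem_antidiagonal] at hp
    rcases i with _ | i
    · obtain rfl : j = k + 1 := by simpa using hp
      simp [greenIterate_succ_one]
    · simp [greenIterate_succ_one]

theorem greenMoment_zero : greenMoment 0 = 1 := greenPrimitive_zero 1

/-- Integrate the constant energy over the unit interval: each of its `(k + 2) + (k + 1)` products
integrates to `greenMoment (k + 1)`. -/
theorem greenMoment_succ (k : ℕ) : (2 * k + 3 : ℝ) * greenMoment (k + 1) =
    ∑ p ∈ Finset.HasAntidiagonal.antidiagonal k, greenMoment p.1 * greenMoment p.2 := by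
  have h : ∫ x in (0 : ℝ)..1, greenEnergy k x =
      ∑ p ∈ Finset.HasAntidiagonal.antidiagonal k, greenMoment p.1 * greenMoment p.2 := by
    simp [greenEnergy_eq]
  rw [← h]
  unfold greenEnergy
  have hv := continuous_greenIterate
  have hw := continuous_greenPrimitive
  rw [intervalIntegral.integral_add, intervalIntegral.integral_finsetSum,
    intervalIntegral.integral_finsetSum]
  · simp only [integral_greenIterate_mul, integral_greenPrimitive_mul]
    rw [Finset.sum_congr rfl (g := fun _ => greenMoment (k + 1)),
      Finset.sum_congr (s₂ := Finset.HasAntidiagonal.antidiagonal k) rfl (g := fun _ => greenMoment (k + 1))]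
    · simp
      ring
    · intro p hp
      rw [Finset.HasAntidiagonal.mem_antidiagonal.1 hp]
    · intro p hp
      rw [Finset.HasAntidiagonal.mem_antidiagonal.1 hp]
  · exact fun p _ => ((hw _).mul (hw _)).intervalIntegrable _ _
  · exact fun p _ => ((hv _).mul (hv _)).intervalIntegrable _ _
  · exact (continuous_finsetSum _ fun p _ => (hv _).mul (hv _)).intervalIntegrable _ _
  · exact (continuous_finsetSum _ fun p _ => (hw _).mul (hw _)).intervalIntegrable _ _

/-! ### Positivity and strict log-convexity of the moments -/

theorem greenMoment_pos (k : ℕ) : 0 < greenMoment k := by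
  induction k using Nat.strong_induction_on with
  | _ k ih =>
    rcases k with _ | k
    · rw [greenMoment_zero]
      exact one_pos
    · have h := greenMoment_succ k
      have h' : 0 < ∑ p ∈ Finset.HasAntidiagonal.antidiagonal k, greenMoment p.1 * greenMoment p.2 := by
        apply Finset.sum_pos
        · intro p hp
          rw [Finset.HasAntidiagonal.mem_antidiagonal] at hp
          exact mul_pos (ih _ (by omega)) (ih _ (by omega))
        · exact ⟨(0, k), by simp⟩
      rw [← h] at h'
      exact pos_of_mul_pos_right h' (by positivity)

theorem eq_zero_of_hasDerivAt_of_eqOn_zero {f : ℝ → ℝ} {s : Set ℝ} (hs : IsOpen s)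
    (hf : ∀ x ∈ s, f x = 0) {x y : ℝ} (hx : x ∈ s) (h : HasDerivAt f y x) : y = 0 := by
  have h' : HasDerivAt f 0 x := (hasDerivAt_const x (0 : ℝ)).congr_of_eventuallyEq
    (Filter.eventually_of_mem (hs.mem_nhds hx) hf)
  exact h.unique h'

/-- A linear relation can be differentiated, which lowers it alternately from primitives to iterates
and from iterates to primitives of the previous index. It ends at `1 + s * greenIterate 1 x = 0`,
whose derivative `-s x` gives `s = 0`, a contradiction. -/
theorem not_forall_greenIterate_add_mul_eq_zero (i : ℕ) (s : ℝ) :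
    (¬ ∀ x ∈ Set.Ioo (0 : ℝ) 1, greenIterate i x + s * greenIterate (i + 1) x = 0) ∧
      ¬ ∀ x ∈ Set.Ioo (0 : ℝ) 1, greenPrimitive i x + s * greenPrimitive (i + 1) x = 0 := by
  have hw : ∀ i, (¬ ∀ x ∈ Set.Ioo (0 : ℝ) 1, greenIterate i x + s * greenIterate (i + 1) x = 0) →
      ¬ ∀ x ∈ Set.Ioo (0 : ℝ) 1, greenPrimitive i x + s * greenPrimitive (i + 1) x = 0 := by
    intro i h h'
    exact h fun x hx => eq_zero_of_hasDerivAt_of_eqOn_zero isOpen_Ioo h' hx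
      ((hasDerivAt_greenPrimitive i x).add ((hasDerivAt_greenPrimitive (i + 1) x).const_mul s))
  suffices hv : ¬ ∀ x ∈ Set.Ioo (0 : ℝ) 1, greenIterate i x + s * greenIterate (i + 1) x = 0 from
    ⟨hv, hw i hv⟩
  induction i with
  | zero =>
    intro h
    have hmem : (1 / 2 : ℝ) ∈ Set.Ioo (0 : ℝ) 1 := by norm_num
    have h₁ := eq_zero_of_hasDerivAt_of_eqOn_zero isOpen_Ioo h hmem
      ((hasDerivAt_const _ (1 : ℝ)).add ((hasDerivAt_greenIterate_succ 0 _).const_mul s))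
    rw [greenPrimitive_zero] at h₁
    obtain rfl : s = 0 := by linarith
    simpa [greenIterate] using h _ hmem
  | succ i ih =>
    intro h
    refine hw i ih fun x hx => ?_
    have h₁ := eq_zero_of_hasDerivAt_of_eqOn_zero isOpen_Ioo h hx
      ((hasDerivAt_greenIterate_succ i x).add
        ((hasDerivAt_greenIterate_succ (i + 1) x).const_mul s))
    linarith

theorem sq_integral_mul_lt {f g : ℝ → ℝ} (hf : Continuous f) (hg : Continuous g)
    (hpos : 0 < ∫ x in (0 : ℝ)..1, g x * g x)
    (h : ∀ s : ℝ, ¬ ∀ x ∈ Set.Ioo (0 : ℝ) 1, f x + s * g x = 0) :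
    (∫ x in (0 : ℝ)..1, f x * g x) ^ 2 <
      (∫ x in (0 : ℝ)..1, f x * f x) * ∫ x in (0 : ℝ)..1, g x * g x := by
  set A := ∫ x in (0 : ℝ)..1, f x * f x
  set B := ∫ x in (0 : ℝ)..1, f x * g x
  set C := ∫ x in (0 : ℝ)..1, g x * g x
  have key : ∀ s : ℝ, 0 < A + 2 * s * B + s ^ 2 * C := by
    intro s
    have h₁ : ∫ x in (0 : ℝ)..1, (f x + s * g x) ^ 2 = A + 2 * s * B + s ^ 2 * C := by
      have e : ∀ x, (f x + s * g x) ^ 2 =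
          f x * f x + 2 * s * (f x * g x) + s ^ 2 * (g x * g x) := fun x => by ring
      simp only [e]
      rw [intervalIntegral.integral_add, intervalIntegral.integral_add,
        intervalIntegral.integral_const_mul, intervalIntegral.integral_const_mul]
      all_goals exact Continuous.intervalIntegrable (by fun_prop) _ _
    rw [← h₁]
    obtain ⟨x, hx, hne⟩ : ∃ x ∈ Set.Ioo (0 : ℝ) 1, f x + s * g x ≠ 0 := by
      have := h s
      push Not at this
      exact this
    exact intervalIntegral.integral_pos one_pos (by fun_prop) (fun x _ => sq_nonneg _)
      ⟨x, Set.Ioo_subset_Icc_self hx, by positivity⟩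
  -- The minimizer of the quadratic in `s`.
  have h₂ := key (-(B / C))
  have h₃ : A + 2 * (-(B / C)) * B + (-(B / C)) ^ 2 * C = (A * C - B ^ 2) / C := by
    field_simp
    ring
  rw [h₃] at h₂
  have := (div_pos_iff_of_pos_right hpos).1 h₂
  linarith

/-- Pairing iterates gives the inequality for even `k`, pairing primitives gives it for odd `k`. -/
theorem greenMoment_sq_lt (k : ℕ) :
    greenMoment (k + 1) ^ 2 < greenMoment k * greenMoment (k + 2) := by
  obtain ⟨i, rfl | rfl⟩ := Nat.even_or_odd' k
  · have h := sq_integral_mul_lt (continuous_greenIterate i) (continuous_greenIterate (i + 1))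
      (by rw [integral_greenIterate_mul]; exact greenMoment_pos _)
      fun s => (not_forall_greenIterate_add_mul_eq_zero i s).1
    simp only [integral_greenIterate_mul] at h
    rwa [show i + (i + 1) = 2 * i + 1 by ring, show i + i = 2 * i by ring,
      show i + 1 + (i + 1) = 2 * i + 2 by ring] at h
  · have h := sq_integral_mul_lt (continuous_greenPrimitive i) (continuous_greenPrimitive (i + 1))
      (by rw [integral_greenPrimitive_mul]; exact greenMoment_pos _)
      fun s => (not_forall_greenIterate_add_mul_eq_zero i s).2
    simp only [integral_greenPrimitive_mul] at h
    rwa [show i + (i + 1) + 1 = 2 * i + 1 + 1 by ring, show i + i + 1 = 2 * i + 1 by ring,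
      show i + 1 + (i + 1) + 1 = 2 * i + 1 + 2 by ring] at h

/-- Strict log-convexity of the sequence of moments. -/
theorem greenMoment_mul_lt {i j l m : ℕ} (hil : i < l) (hlm : l ≤ m) (h : i + j = l + m) :
    greenMoment l * greenMoment m < greenMoment i * greenMoment j := by
  have hratio : StrictMono fun k => greenMoment (k + 1) / greenMoment k := by
    apply strictMono_nat_of_lt_succ
    intro k
    rw [div_lt_div_iff₀ (greenMoment_pos _) (greenMoment_pos _)]
    nlinarith [greenMoment_sq_lt k]
  obtain ⟨d, rfl⟩ := Nat.exists_eq_add_of_lt hil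
  clear hil
  obtain rfl : j = m + d + 1 := by omega
  clear h
  induction d generalizing m with
  | zero =>
    have := hratio (show i < m by omega)
    simp only at this
    rw [div_lt_div_iff₀ (greenMoment_pos _) (greenMoment_pos _)] at this
    simp only [add_zero]
    linarith
  | succ d ih =>
    have h₁ := hratio (show i + d + 1 < m by omega)
    simp only at h₁
    rw [div_lt_div_iff₀ (greenMoment_pos _) (greenMoment_pos _)] at h₁
    have h₂ := ih (m := m + 1) (by omega)
    rw [show m + (d + 1) + 1 = m + 1 + d + 1 by omega]
    rw [show i + (d + 1) + 1 = i + d + 1 + 1 by omega]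
    linarith

/-! ### The recursion for the coefficients -/

/-- The **cd**-index of the Boolean lattice of rank `n`, divided by `n!`, in terms of the recursion
`2 Ψ' = 2 + c Ψ + Ψ c + Ψ d Ψ` for the exponential generating function. -/
noncomputable def booleanCD : ℕ → FreeAlgebra ℚ CDVar
  | 0 => 0
  | n + 1 => (2 * (n + 1) : ℚ)⁻¹ • ((if n = 0 then (2 : ℚ) • 1 else 0) +
      FreeAlgebra.ι ℚ CDVar.c * booleanCD n + booleanCD n * FreeAlgebra.ι ℚ CDVar.c +
      ∑ p : Finset.HasAntidiagonal.antidiagonal n,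
        booleanCD p.1.1 * FreeAlgebra.ι ℚ CDVar.d * booleanCD p.1.2)
termination_by n => n
decreasing_by
  · omega
  · have := Finset.HasAntidiagonal.mem_antidiagonal.1 p.2; omega
  · have := Finset.HasAntidiagonal.mem_antidiagonal.1 p.2; omega

theorem booleanCD_zero : booleanCD 0 = 0 := by rw [booleanCD]

theorem booleanCD_succ (n : ℕ) : (2 * (n + 1) : ℚ) • booleanCD (n + 1) =
    (if n = 0 then (2 : ℚ) • 1 else 0) +
      FreeAlgebra.ι ℚ CDVar.c * booleanCD n + booleanCD n * FreeAlgebra.ι ℚ CDVar.c +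
      ∑ p ∈ Finset.HasAntidiagonal.antidiagonal n,
        booleanCD p.1 * FreeAlgebra.ι ℚ CDVar.d * booleanCD p.2 := by
  rw [booleanCD, smul_smul, mul_inv_cancel₀ (by positivity), one_smul,
    Finset.sum_coe_sort (Finset.HasAntidiagonal.antidiagonal n)
      (fun p => booleanCD p.1 * FreeAlgebra.ι ℚ CDVar.d * booleanCD p.2)]

/-- The sum of `p u * q v` over all factorizations `w = u d v`. -/
def dSplitSum : (List CDVar → ℚ) → (List CDVar → ℚ) → List CDVar → ℚ
  | _, _, [] => 0
  | p, q, .c :: w => dSplitSum (fun u => p (.c :: u)) q w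
  | p, q, .d :: w => p [] * q w + dSplitSum (fun u => p (.d :: u)) q w

theorem wordCoeff_mul_d_mul (p q : FreeAlgebra ℚ CDVar) (w : List CDVar) :
    wordCoeff (p * FreeAlgebra.ι ℚ CDVar.d * q) w = dSplitSum (wordCoeff p) (wordCoeff q) w := by
  classical
  induction w generalizing p with
  | nil =>
    obtain ⟨k, p₁, p₂, rfl⟩ := CDVar.exists_decomposition p
    simp [add_mul, mul_assoc, wordCoeff_ι_mul_nil, dSplitSum]
  | cons x w ih =>
    obtain ⟨k, p₁, p₂, rfl⟩ := CDVar.exists_decomposition p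
    have h := ih p₁
    have h' := ih p₂
    rw [mul_assoc] at h h'
    cases x <;>
      simp [add_mul, mul_assoc, wordCoeff_ι_mul_nil, dSplitSum, wordCoeff_ι_mul_cons,
        wordCoeff_one_cons, wordCoeff_one_nil, h, h']

theorem exists_of_dSplitSum_ne_zero {p q : List CDVar → ℚ} {w : List CDVar}
    (h : dSplitSum p q w ≠ 0) : ∃ u v, w = u ++ .d :: v ∧ p u ≠ 0 ∧ q v ≠ 0 := by
  induction w generalizing p with
  | nil => exact absurd rfl h
  | cons x w ih =>
    cases x with
    | c =>
      obtain ⟨u, v, rfl, hu, hv⟩ := ih h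
      exact ⟨.c :: u, v, rfl, hu, hv⟩
    | d =>
      by_cases h' : p [] * q w = 0
      · rw [dSplitSum, h', zero_add] at h
        obtain ⟨u, v, rfl, hu, hv⟩ := ih h
        exact ⟨.d :: u, v, rfl, hu, hv⟩
      · exact ⟨[], w, rfl, left_ne_zero_of_mul h', right_ne_zero_of_mul h'⟩

/-- Serves to collapse the sum over pairs of ranks in the recursion: for each factorization `w = u d
v` only one pair has the right degrees. -/
theorem sum_dSplitSum_eq {ι : Type*} (s : Finset ι) (p q : ι → List CDVar → ℚ)
    (P Q : List CDVar → ℚ) (w : List CDVar)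
    (h : ∀ u v, w = u ++ .d :: v → ∑ i ∈ s, p i u * q i v = P u * Q v) :
    ∑ i ∈ s, dSplitSum (p i) (q i) w = dSplitSum P Q w := by
  induction w generalizing p P with
  | nil => simp [dSplitSum]
  | cons x w ih =>
    cases x with
    | c =>
      exact ih (fun i u => p i (.c :: u)) (fun u => P (.c :: u))
        fun u v hw => h (.c :: u) v (by rw [hw]; rfl)
    | d =>
      simp only [dSplitSum, Finset.sum_add_distrib]
      rw [h [] w rfl, ih (fun i u => p i (.d :: u)) (fun u => P (.d :: u))
        fun u v hw => h (.d :: u) v (by rw [hw]; rfl)]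

theorem dSplitSum_replicate_d_append (p q : List CDVar → ℚ) (i : ℕ) (w : List CDVar) :
    dSplitSum p q (List.replicate i .d ++ w) =
      ∑ k ∈ Finset.range i, p (List.replicate k .d) * q (List.replicate (i - 1 - k) .d ++ w) +
        dSplitSum (fun u => p (List.replicate i .d ++ u)) q w := by
  induction i generalizing p with
  | zero => simp
  | succ i ih =>
    rw [List.replicate_succ, List.cons_append, dSplitSum, ih, Finset.sum_range_succ']
    have e : ∀ k ∈ Finset.range i, p (List.replicate (k + 1) .d) *
        q (List.replicate (i + 1 - 1 - (k + 1)) .d ++ w) = p (.d :: List.replicate k .d) *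
        q (List.replicate (i - 1 - k) .d ++ w) := fun k _ => by
      rw [List.replicate_succ, show i + 1 - 1 - (k + 1) = i - 1 - k by omega]
    rw [Finset.sum_congr rfl e]
    simp only [List.cons_append, Nat.add_sub_cancel, Nat.sub_zero, List.replicate_zero]
    ring

/-- The degree of a **cd**-word. -/
def wordDegree (l : List CDVar) : ℕ := cdDegree (FreeMonoid.ofList l)

theorem wordDegree_nil : wordDegree [] = 0 := rfl

theorem wordDegree_c_cons (l : List CDVar) : wordDegree (.c :: l) = wordDegree l + 1 := by
  simp [wordDegree, cdDegree, add_comm]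

theorem wordDegree_d_cons (l : List CDVar) : wordDegree (.d :: l) = wordDegree l + 2 := by
  simp [wordDegree, cdDegree, add_comm]

theorem wordDegree_append (l m : List CDVar) :
    wordDegree (l ++ m) = wordDegree l + wordDegree m := by
  simp [wordDegree, cdDegree]

theorem wordDegree_replicate_d (k : ℕ) : wordDegree (List.replicate k .d) = 2 * k := by
  simp [wordDegree, cdDegree, mul_comm]

theorem wordDegree_eq_zero {l : List CDVar} (h : wordDegree l = 0) : l = [] := by
  rcases l with _ | ⟨_ | _, l⟩
  · rfl
  · simp [wordDegree_c_cons] at h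
  · simp [wordDegree_d_cons] at h

theorem wordCoeff_smul_one {X : Type*} (k : ℚ) {w : List X} (hw : w ≠ []) :
    wordCoeff (k • 1) w = 0 := by
  obtain ⟨x, w, rfl⟩ := List.exists_cons_of_ne_nil hw
  simp [wordCoeff_one_cons]

/-- `booleanCD n` is homogeneous of degree `n - 1`, since every term of its recursion is. -/
theorem wordDegree_eq_of_wordCoeff_booleanCD_ne_zero {n : ℕ} {w : List CDVar}
    (h : wordCoeff (booleanCD n) w ≠ 0) : wordDegree w + 1 = n := by
  classical
  induction n using Nat.strong_induction_on generalizing w with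
  | _ n ih =>
    rcases n with _ | n
    · simp [booleanCD_zero] at h
    · by_contra hne
      apply h
      have hne' : wordDegree w ≠ n := fun h => hne (by rw [h])
      have key := congrFun (congrArg wordCoeff (booleanCD_succ n)) w
      have h₁ : wordCoeff (if n = 0 then (2 : ℚ) • 1 else 0 : FreeAlgebra ℚ CDVar) w = 0 := by
        split_ifs with hn
        · exact wordCoeff_smul_one _ (by rintro rfl; exact hne' hn.symm)
        · simp
      have h₂ : wordCoeff (FreeAlgebra.ι ℚ CDVar.c * booleanCD n) w = 0 := by
        rcases w with _ | ⟨x, w⟩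
        · exact wordCoeff_ι_mul_nil _ _
        · rw [wordCoeff_ι_mul_cons]
          split_ifs with hx
          · subst hx
            by_contra h'
            exact hne' ((wordDegree_c_cons w).trans (ih n (by omega) h'))
          · rfl
      have h₃ : wordCoeff (booleanCD n * FreeAlgebra.ι ℚ CDVar.c) w = 0 := by
        rcases List.eq_nil_or_concat' w with rfl | ⟨w, x, rfl⟩
        · exact wordCoeff_mul_ι_nil _ _
        · rw [wordCoeff_mul_ι_concat]
          split_ifs with hx
          · subst hx
            by_contra h'
            refine hne' ?_
            rw [wordDegree_append, wordDegree_c_cons, wordDegree_nil]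
            exact ih n (by omega) h'
          · rfl
      have h₄ : wordCoeff (∑ p ∈ Finset.HasAntidiagonal.antidiagonal n,
          booleanCD p.1 * FreeAlgebra.ι ℚ CDVar.d * booleanCD p.2) w = 0 := by
        rw [map_sum, Finset.sum_apply]
        refine Finset.sum_eq_zero fun p hp => ?_
        rw [Finset.HasAntidiagonal.mem_antidiagonal] at hp
        rw [wordCoeff_mul_d_mul]
        by_contra h'
        obtain ⟨u, v, rfl, hu, hv⟩ := exists_of_dSplitSum_ne_zero h'
        have hu' := ih _ (by omega) hu
        have hv' := ih _ (by omega) hv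
        rw [wordDegree_append, wordDegree_d_cons] at hne'
        omega
      rw [map_add, map_add, map_add] at key
      simp only [Pi.add_apply, h₁, h₂, h₃, h₄, map_smul, Pi.smul_apply, add_zero,
        smul_eq_mul] at key
      exact (mul_eq_zero.1 key).resolve_left (by positivity)

/-- The coefficient of a word `w` in the **cd**-index of the Boolean lattice of rank
`n = deg w + 1`, divided by `n!`. -/
noncomputable def gammaWord (w : List CDVar) : ℚ := wordCoeff (booleanCD (wordDegree w + 1)) w

theorem gammaWord_rec (w : List CDVar) : (2 * (wordDegree w + 1) : ℚ) * gammaWord w =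
    (if w = [] then 2 else 0) +
      wordCoeff (FreeAlgebra.ι ℚ CDVar.c * booleanCD (wordDegree w)) w +
      wordCoeff (booleanCD (wordDegree w) * FreeAlgebra.ι ℚ CDVar.c) w +
      dSplitSum gammaWord gammaWord w := by
  have key := congrFun (congrArg wordCoeff (booleanCD_succ (wordDegree w))) w
  rw [map_add, map_add, map_add, map_sum] at key
  simp only [Pi.add_apply, Finset.sum_apply, map_smul, Pi.smul_apply, smul_eq_mul,
    wordCoeff_mul_d_mul] at key
  rw [gammaWord, key]
  congr 1
  · congr 2
    by_cases hw : w = []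
    · subst hw
      simp [wordDegree_nil, wordCoeff_one_nil]
    · rw [if_neg hw, if_neg fun h => hw (wordDegree_eq_zero h)]
      simp
  · apply sum_dSplitSum_eq (Finset.HasAntidiagonal.antidiagonal (wordDegree w))
      (fun p => wordCoeff (booleanCD p.1)) (fun p => wordCoeff (booleanCD p.2))
    intro u v hw
    -- By homogeneity the two ranks are determined by the degrees of `u` and `v`.
    rw [Finset.sum_eq_single (wordDegree u + 1, wordDegree v + 1)]
    · rfl
    · rintro ⟨i, j⟩ _ hne
      by_contra h
      have hu := wordDegree_eq_of_wordCoeff_booleanCD_ne_zero (left_ne_zero_of_mul h)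
      have hv := wordDegree_eq_of_wordCoeff_booleanCD_ne_zero (right_ne_zero_of_mul h)
      exact hne (by rw [hu, hv])
    · intro h
      refine absurd (Finset.HasAntidiagonal.mem_antidiagonal.2 ?_) h
      rw [hw, wordDegree_append, wordDegree_d_cons]
      ring

/-! ### Closed forms for words with at most two letters `c` -/

/-- The normalized coefficient of `d^k`. -/
noncomputable def gammaD (k : ℕ) : ℚ := gammaWord (List.replicate k .d)

theorem wordCoeff_c_mul_replicate_d_append (p : FreeAlgebra ℚ CDVar) (i : ℕ) (w : List CDVar) :
    wordCoeff (FreeAlgebra.ι ℚ CDVar.c * p) (List.replicate i .d ++ .c :: w) =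
      if i = 0 then wordCoeff p w else 0 := by
  classical
  rcases i with _ | i
  · simp [wordCoeff_ι_mul_cons]
  · simp [List.replicate_succ, wordCoeff_ι_mul_cons]

theorem wordCoeff_mul_c_append_replicate_d (p : FreeAlgebra ℚ CDVar) (j : ℕ) (w : List CDVar) :
    wordCoeff (p * FreeAlgebra.ι ℚ CDVar.c) (w ++ .c :: List.replicate j .d) =
      if j = 0 then wordCoeff p w else 0 := by
  classical
  rcases j with _ | j
  · simp [wordCoeff_mul_ι_concat]
  · rw [List.replicate_succ', ← List.cons_append, ← List.append_assoc, wordCoeff_mul_ι_concat]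
    simp

theorem gammaD_rec (k : ℕ) : (2 * (2 * k + 1) : ℚ) * gammaD k =
    (if k = 0 then 2 else 0) + ∑ l ∈ Finset.range k, gammaD l * gammaD (k - 1 - l) := by
  classical
  have h := gammaWord_rec (List.replicate k .d)
  have h₁ : ∀ p, wordCoeff (FreeAlgebra.ι ℚ CDVar.c * p) (List.replicate k .d) = 0 := by
    intro p
    rcases k with _ | k
    · exact wordCoeff_ι_mul_nil _ _
    · simp [List.replicate_succ, wordCoeff_ι_mul_cons]
  have h₂ : ∀ p, wordCoeff (p * FreeAlgebra.ι ℚ CDVar.c) (List.replicate k .d) = 0 := by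
    intro p
    rcases k with _ | k
    · exact wordCoeff_mul_ι_nil _ _
    · simp [List.replicate_succ', wordCoeff_mul_ι_concat]
  have h₃ := dSplitSum_replicate_d_append gammaWord gammaWord k []
  simp only [List.append_nil, dSplitSum] at h₃
  rw [h₁, h₂, h₃, wordDegree_replicate_d] at h
  simp only [List.replicate_eq_nil_iff, add_zero] at h
  rw [← gammaD] at h
  push_cast at h
  exact h

/-- The block `c :: u` is `c` or `cc`. It contains no `d`, so every splitting letter lies in one of
the outer runs, and deleting its first or its last letter leaves the same `u`. -/
theorem gammaWord_replicate_d_c_rec (u : List CDVar) (i j : ℕ)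
    (hu : u = [] ∨ u = [.c]) :
    (2 * (wordDegree (.c :: u) + 2 * i + 2 * j + 1) : ℚ) *
        gammaWord (List.replicate i .d ++ (.c :: u) ++ List.replicate j .d) =
      (if i = 0 then gammaWord (u ++ List.replicate j .d) else 0) +
      (if j = 0 then gammaWord (List.replicate i .d ++ u) else 0) +
      (∑ k ∈ Finset.range i, gammaD k *
        gammaWord (List.replicate (i - 1 - k) .d ++ (.c :: u) ++ List.replicate j .d) +
      ∑ k ∈ Finset.range j, gammaWord (List.replicate i .d ++ (.c :: u) ++ List.replicate k .d) *
        gammaD (j - 1 - k)) := by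
  have hdeg : wordDegree (List.replicate i .d ++ (.c :: u) ++ List.replicate j .d) =
      wordDegree (.c :: u) + 2 * i + 2 * j := by
    rw [wordDegree_append, wordDegree_append, wordDegree_replicate_d, wordDegree_replicate_d]
    ring
  have h := gammaWord_rec (List.replicate i .d ++ (.c :: u) ++ List.replicate j .d)
  have hs : dSplitSum gammaWord gammaWord
      (List.replicate i .d ++ (.c :: u) ++ List.replicate j .d) =
      ∑ k ∈ Finset.range i, gammaD k *
        gammaWord (List.replicate (i - 1 - k) .d ++ (.c :: u) ++ List.replicate j .d) +
      ∑ k ∈ Finset.range j, gammaWord (List.replicate i .d ++ (.c :: u) ++ List.replicate k .d) *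
        gammaD (j - 1 - k) := by
    have e := dSplitSum_replicate_d_append
      (fun v => gammaWord (List.replicate i .d ++ (.c :: u) ++ v)) gammaWord j []
    simp only [List.append_nil, dSplitSum, add_zero] at e
    rw [List.append_assoc, dSplitSum_replicate_d_append]
    simp only [← List.append_assoc]
    congr 1
    refine Eq.trans ?_ e
    rcases hu with rfl | rfl <;> simp [dSplitSum]
  rw [hs] at h
  have h₁ := wordCoeff_c_mul_replicate_d_append
    (booleanCD (wordDegree (List.replicate i .d ++ (.c :: u) ++ List.replicate j .d))) i
    (u ++ List.replicate j .d)
  rw [← List.cons_append, ← List.append_assoc] at h₁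
  have h₂ : wordCoeff (booleanCD (wordDegree
      (List.replicate i .d ++ (.c :: u) ++ List.replicate j .d)) * FreeAlgebra.ι ℚ CDVar.c)
      (List.replicate i .d ++ (.c :: u) ++ List.replicate j .d) =
      if j = 0 then wordCoeff (booleanCD (wordDegree
      (List.replicate i .d ++ (.c :: u) ++ List.replicate j .d))) (List.replicate i .d ++ u)
      else 0 := by
    rw [← wordCoeff_mul_c_append_replicate_d]
    rcases hu with rfl | rfl <;> simp
  rw [h₁, h₂, hdeg, if_neg (by simp)] at h
  push_cast at h
  rw [h, zero_add]
  congr 2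
  · split_ifs with hi
    · rw [gammaWord, wordDegree_append, wordDegree_replicate_d, wordDegree_c_cons, hi]
      ring_nf
    · rfl
  · split_ifs with hj
    · rw [gammaWord, wordDegree_append, wordDegree_replicate_d, wordDegree_c_cons, hj]
      ring_nf
    · rfl

/-- By induction the two sums become the convolutions of `gammaD_rec` for `i` and `j`, each times
the other factor. The weights add up, `(2i + 1) + (2j + 1) = 2i + 2j + 2`, and the terms for `i = 0`
or `j = 0` cancel the initial terms of `gammaD_rec`. -/
theorem gammaWord_d_c_d (i j : ℕ) :
    gammaWord (List.replicate i .d ++ [.c] ++ List.replicate j .d) = gammaD i * gammaD j / 2 := by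
  induction h : i + j using Nat.strong_induction_on generalizing i j with
  | _ n ih =>
    have h₁ := gammaWord_replicate_d_c_rec [] i j (.inl rfl)
    have s₁ : ∑ k ∈ Finset.range i, gammaD k *
        gammaWord (List.replicate (i - 1 - k) .d ++ [.c] ++ List.replicate j .d) =
        (∑ k ∈ Finset.range i, gammaD k * gammaD (i - 1 - k)) * (gammaD j / 2) := by
      rw [Finset.sum_mul]
      refine Finset.sum_congr rfl fun k hk => ?_
      rw [Finset.mem_range] at hk
      rw [ih _ (by omega) _ _ rfl]
      ring
    have s₂ : ∑ k ∈ Finset.range j,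
        gammaWord (List.replicate i .d ++ [.c] ++ List.replicate k .d) * gammaD (j - 1 - k) =
        (∑ k ∈ Finset.range j, gammaD k * gammaD (j - 1 - k)) * (gammaD i / 2) := by
      rw [Finset.sum_mul]
      refine Finset.sum_congr rfl fun k hk => ?_
      rw [Finset.mem_range] at hk
      rw [ih _ (by omega) _ _ rfl]
      ring
    have e₁ := gammaD_rec i
    have e₂ := gammaD_rec j
    rw [s₁, s₂, wordDegree_c_cons, wordDegree_nil, List.nil_append, List.append_nil, ← gammaD,
      ← gammaD, ← sub_eq_iff_eq_add'.2 e₁, ← sub_eq_iff_eq_add'.2 e₂] at h₁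
    have hpos : (2 * (1 + 2 * i + 2 * j + 1) : ℚ) ≠ 0 := by positivity
    apply mul_left_cancel₀ hpos
    push_cast at h₁
    rw [h₁]
    split_ifs <;> subst_vars <;> push_cast <;> ring

/-- As for a single `c`, but the corrections from the two sums also form the convolution of
`gammaD_rec` for `i + j + 1`, apart from its term `k = i`. That missing term `γ_i γ_j` makes up the
deficit between the weights `2i + 2j + 2` and `2i + 2j + 3`. -/
theorem gammaWord_d_c_c_d (i j : ℕ) :
    gammaWord (List.replicate i .d ++ [.c, .c] ++ List.replicate j .d) =
      gammaD i * gammaD j / 4 - gammaD (i + j + 1) / 2 := by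
  induction h : i + j using Nat.strong_induction_on generalizing i j with
  | _ n ih =>
    subst h
    have h₁ := gammaWord_replicate_d_c_rec [.c] i j (.inr rfl)
    have s₁ : ∑ k ∈ Finset.range i, gammaD k *
        gammaWord (List.replicate (i - 1 - k) .d ++ [.c, .c] ++ List.replicate j .d) =
        (∑ k ∈ Finset.range i, gammaD k * gammaD (i - 1 - k)) * (gammaD j / 4) -
        (∑ k ∈ Finset.range i, gammaD k * gammaD (i + j - k)) / 2 := by
      rw [Finset.sum_mul, Finset.sum_div, ← Finset.sum_sub_distrib]
      refine Finset.sum_congr rfl fun k hk => ?_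
      rw [Finset.mem_range] at hk
      rw [ih _ (by omega) _ _ rfl, show i - 1 - k + j + 1 = i + j - k by omega]
      ring
    have s₂ : ∑ k ∈ Finset.range j,
        gammaWord (List.replicate i .d ++ [.c, .c] ++ List.replicate k .d) * gammaD (j - 1 - k) =
        (∑ k ∈ Finset.range j, gammaD k * gammaD (j - 1 - k)) * (gammaD i / 4) -
        (∑ k ∈ Finset.range j, gammaD (i + (1 + k)) * gammaD (i + j - (i + (1 + k)))) / 2 := by
      rw [Finset.sum_mul, Finset.sum_div, ← Finset.sum_sub_distrib]
      refine Finset.sum_congr rfl fun k hk => ?_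
      rw [Finset.mem_range] at hk
      rw [ih _ (by omega) _ _ rfl, show i + j - (i + (1 + k)) = j - 1 - k by omega,
        show i + (1 + k) = i + k + 1 by ring]
      ring
    have e₁ := gammaD_rec i
    have e₂ := gammaD_rec j
    have e₃ := gammaD_rec (i + j + 1)
    rw [if_neg (by omega), show i + j + 1 - 1 = i + j by omega,
      show i + j + 1 = i + (1 + j) by ring, Finset.sum_range_add, Finset.sum_range_add] at e₃
    simp only [Finset.sum_range_one, add_zero, Nat.add_sub_cancel_left] at e₃
    have g₁ := gammaWord_d_c_d 0 j
    have g₂ := gammaWord_d_c_d i 0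
    have g₀ := gammaD_rec 0
    simp only [List.replicate_zero, List.nil_append, List.append_nil] at g₁ g₂
    simp only [Nat.cast_zero, mul_zero, zero_add, mul_one, if_true, Finset.range_zero,
      Finset.sum_empty, add_zero] at g₀
    have g₀' : gammaD 0 = 1 := by linarith
    rw [s₁, s₂, wordDegree_c_cons, wordDegree_c_cons, wordDegree_nil, g₁, g₂, g₀'] at h₁
    have hpos : (2 * (2 + 2 * i + 2 * j + 1) : ℚ) ≠ 0 := by positivity
    apply mul_left_cancel₀ hpos
    push_cast at h₁ e₃
    rw [h₁, show i + j + 1 = i + (1 + j) by ring]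
    have a₁ : (if i = 0 then 1 * gammaD j / 2 else 0 : ℚ) = (if i = 0 then 2 else 0) * gammaD j / 4 := by
      split_ifs <;> ring
    have a₂ : (if j = 0 then gammaD i * 1 / 2 else 0 : ℚ) = (if j = 0 then 2 else 0) * gammaD i / 4 := by
      split_ifs <;> ring
    rw [a₁, a₂]
    linear_combination (-(gammaD j) / 4) * e₁ - (gammaD i / 4) * e₂ + e₃ / 2

/-- The normalized coefficients of `d^k` are moments up to scaling. -/
theorem gammaD_eq (k : ℕ) : (gammaD k : ℝ) = greenMoment k / 2 ^ k := by
  induction k using Nat.strong_induction_on with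
  | _ k ih =>
    have h := congrArg (Rat.cast : ℚ → ℝ) (gammaD_rec k)
    rcases k with _ | k
    · simp at h
      simp [greenMoment_zero, h]
    · have h' := greenMoment_succ k
      rw [Finset.Nat.sum_antidiagonal_eq_sum_range_succ
        (fun i j => greenMoment i * greenMoment j)] at h'
      simp only [Nat.add_sub_cancel] at h
      push_cast [Rat.cast_sum] at h
      have e : ∑ l ∈ Finset.range (k + 1), (gammaD l : ℝ) * gammaD (k - l) =
          (∑ l ∈ Finset.range (k + 1), greenMoment l * greenMoment (k - l)) / 2 ^ k := by
        rw [Finset.sum_div]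
        refine Finset.sum_congr rfl fun l hl => ?_
        rw [Finset.mem_range] at hl
        rw [ih _ (by omega), ih _ (by omega), div_mul_div_comm, ← pow_add,
          Nat.add_sub_cancel' (by omega)]
      rw [e, ← h', zero_add] at h
      have hpos : (2 * k + 3 : ℝ) ≠ 0 := by positivity
      rw [pow_succ]
      field_simp at h ⊢
      apply mul_left_cancel₀ hpos
      linear_combination h

theorem gammaD_mul_lt {i j l m : ℕ} (hil : i < l) (hlm : l ≤ m) (h : i + j = l + m) :
    gammaD l * gammaD m < gammaD i * gammaD j := by
  have h' : (gammaD l * gammaD m : ℝ) < gammaD i * gammaD j := by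
    rw [gammaD_eq, gammaD_eq, gammaD_eq, gammaD_eq, div_mul_div_comm, div_mul_div_comm, ← pow_add,
      ← pow_add, h]
    exact div_lt_div_of_pos_right (greenMoment_mul_lt hil hlm h) (by positivity)
  exact_mod_cast h'

/-! ### The flag f-vector and the **ab**-index of the Boolean lattice -/

open Classical in
/-- The chains of subsets of `Fin m` whose set of cardinalities is `T`. -/
noncomputable def flagChains (m : ℕ) (T : Finset ℕ) : Finset (Finset (Finset (Fin m))) :=
  Finset.univ.filter fun C => IsChain (· ≤ ·) (C : Set (Finset (Fin m))) ∧ C.image Finset.card = T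

theorem mem_flagChains {m : ℕ} {T : Finset ℕ} {C : Finset (Finset (Fin m))} :
    C ∈ flagChains m T ↔
      IsChain (· ≤ ·) (C : Set (Finset (Fin m))) ∧ C.image Finset.card = T := by
  simp [flagChains]

theorem flagF_booleanLattice (m : ℕ) (T : Finset ℕ) :
    flagF (BooleanLattice m) T = (flagChains m T).card := by
  rw [flagF, ← Set.ncard_coe_finset]
  congr 1
  ext C
  simp only [Set.mem_ofPred_eq, Finset.mem_coe, mem_flagChains]
  rfl

theorem card_flagChains_empty (m : ℕ) : (flagChains m ∅).card = 1 := by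
  rw [Finset.card_eq_one]
  refine ⟨∅, ?_⟩
  ext C
  simp only [mem_flagChains, Finset.image_eq_empty, Finset.mem_singleton]
  constructor
  · exact fun h => h.2
  · rintro rfl
    simp

theorem exists_top_of_mem_flagChains_insert {m k : ℕ} {T : Finset ℕ} (hT : ∀ x ∈ T, x < k)
    {C : Finset (Finset (Fin m))} (hC : C ∈ flagChains m (insert k T)) :
    ∃ K ∈ C, K.card = k ∧ ∀ L ∈ C, L ⊆ K := by
  rw [mem_flagChains] at hC
  obtain ⟨K, hK, hKk⟩ := Finset.mem_image.1 (hC.2.symm ▸ Finset.mem_insert_self k T)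
  refine ⟨K, hK, hKk, fun L hL => ?_⟩
  rcases hC.1.total hL hK with h | h
  · exact h
  · have hle : L.card ≤ k := by
      have : L.card ∈ insert k T := hC.2 ▸ Finset.mem_image_of_mem _ hL
      rcases Finset.mem_insert.1 this with h | h
      · exact h.le
      · exact (hT _ h).le
    exact (Finset.eq_of_subset_of_card_le h (hle.trans hKk.ge)).ge

theorem sup_eq_of_top {α : Type*} [DecidableEq α] {C : Finset (Finset α)} {K : Finset α}
    (hK : K ∈ C) (h : ∀ L ∈ C, L ⊆ K) : C.sup id = K :=
  le_antisymm (Finset.sup_le h) (Finset.le_sup (f := id) hK)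

/-- Deleting the top element `K` leaves a chain of subsets of `K`, and the increasing enumeration of
`K` identifies these with subsets of `Fin k`. -/
theorem card_flagChains_insert_filter_sup {m k : ℕ} {T : Finset ℕ} (hT : ∀ x ∈ T, x < k)
    {K : Finset (Fin m)} (hK : K.card = k) :
    ((flagChains m (insert k T)).filter fun C => C.sup id = K).card = (flagChains k T).card := by
  classical
  symm
  set e : Fin k ↪ Fin m := (K.orderEmbOfFin hK).toEmbedding
  have hrange : ∀ x, x ∈ K ↔ ∃ y, e y = x := by
    intro x
    rw [← Finset.mem_coe, ← Finset.range_orderEmbOfFin K hK]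
    rfl
  have hsub : ∀ s : Finset (Fin k), s.map e ⊆ K := by
    intro s x hx
    obtain ⟨y, -, rfl⟩ := Finset.mem_map.1 hx
    exact (hrange _).2 ⟨y, rfl⟩
  have hnot : ∀ C ∈ flagChains k T, K ∉ C.image (Finset.map e) := by
    intro C hC hmem
    obtain ⟨s, hs, hsK⟩ := Finset.mem_image.1 hmem
    have h₁ : s.card ∈ T := (mem_flagChains.1 hC).2 ▸ Finset.mem_image_of_mem _ hs
    have h₂ := hT _ h₁
    have h₃ : s.card = k := by rw [← Finset.card_map e, hsK, hK]
    exact h₂.ne h₃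
  refine Finset.card_bij (fun C _ => insert K (C.image (Finset.map e))) ?_ ?_ ?_
  · intro C hC
    have hC' := mem_flagChains.1 hC
    rw [Finset.mem_filter, mem_flagChains]
    refine ⟨⟨?_, ?_⟩, ?_⟩
    · rw [Finset.coe_insert, Finset.coe_image]
      refine IsChain.insert ?_ ?_
      · rintro _ ⟨s, hs, rfl⟩ _ ⟨t, ht, rfl⟩ -
        exact (hC'.1.total hs ht).imp Finset.map_subset_map.2 Finset.map_subset_map.2
      · rintro _ ⟨s, -, rfl⟩ -
        exact .inr (hsub s)
    · rw [Finset.image_insert, hK, Finset.image_image]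
      congr 1
      rw [← hC'.2]
      exact Finset.image_congr fun s _ => Finset.card_map e
    · apply sup_eq_of_top (Finset.mem_insert_self _ _)
      intro L hL
      rcases Finset.mem_insert.1 hL with rfl | hL
      · exact subset_rfl
      · obtain ⟨s, -, rfl⟩ := Finset.mem_image.1 hL
        exact hsub s
  · intro C hC C' hC' h
    have h' := congrArg (fun D => D.erase K) h
    simp only [Finset.erase_insert (hnot C hC), Finset.erase_insert (hnot C' hC')] at h'
    exact Finset.image_injective (Finset.map_injective e) h'
  · intro C hC
    rw [Finset.mem_filter] at hC
    obtain ⟨hC, hsup⟩ := hC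
    obtain ⟨K', hK'C, -, hK'⟩ := exists_top_of_mem_flagChains_insert hT hC
    obtain rfl : K' = K := (sup_eq_of_top hK'C hK').symm.trans hsup
    have hC' := mem_flagChains.1 hC
    have himage : (Finset.univ.filter fun s : Finset (Fin k) => s.map e ∈ C.erase K').image
        (Finset.map e) = C.erase K' := by
      ext L
      simp only [Finset.mem_image, Finset.mem_filter, Finset.mem_univ, true_and]
      constructor
      · rintro ⟨s, hs, rfl⟩
        exact hs
      · intro hL
        have hLe : (Finset.univ.filter fun y => e y ∈ L).map e = L := by
          ext x
          simp only [Finset.mem_map, Finset.mem_filter, Finset.mem_univ, true_and]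
          constructor
          · rintro ⟨y, hy, rfl⟩
            exact hy
          · intro hx
            obtain ⟨y, rfl⟩ := (hrange x).1 (hK' L (Finset.mem_of_mem_erase hL) hx)
            exact ⟨y, hx, rfl⟩
        exact ⟨_, hLe.symm ▸ hL, hLe⟩
    refine ⟨Finset.univ.filter fun s => s.map e ∈ C.erase K', ?_, ?_⟩
    · rw [mem_flagChains]
      constructor
      · intro s hs t ht hne
        have hs' := Finset.mem_of_mem_erase (Finset.mem_filter.1 hs).2
        have ht' := Finset.mem_of_mem_erase (Finset.mem_filter.1 ht).2
        rcases hC'.1.total hs' ht' with h | h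
        · exact .inl (Finset.map_subset_map.1 h)
        · exact .inr (Finset.map_subset_map.1 h)
      · have h₁ : (Finset.univ.filter fun s : Finset (Fin k) =>
            s.map e ∈ C.erase K').image Finset.card = (C.erase K').image Finset.card := by
          rw [← himage, Finset.image_image, himage]
          exact Finset.image_congr fun s _ => (Finset.card_map e).symm
        rw [h₁]
        have hkT : k ∉ T := fun h => lt_irrefl _ (hT k h)
        rw [← Finset.erase_insert hkT, ← hC'.2]
        ext x
        simp only [Finset.mem_image, Finset.mem_erase]
        constructor
        · rintro ⟨L, ⟨hne, hL⟩, rfl⟩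
          refine ⟨fun h => hne ?_, L, hL, rfl⟩
          exact Finset.eq_of_subset_of_card_le (hK' L hL) (by rw [hK, h])
        · rintro ⟨hne, L, hL, rfl⟩
          refine ⟨L, ⟨?_, hL⟩, rfl⟩
          rintro rfl
          exact hne hK
    · rw [himage, Finset.insert_erase hK'C]

theorem card_flagChains_insert {m k : ℕ} {T : Finset ℕ} (hT : ∀ x ∈ T, x < k) :
    (flagChains m (insert k T)).card = m.choose k * (flagChains k T).card := by
  classical
  have hmaps : ∀ C ∈ flagChains m (insert k T),
      C.sup id ∈ Finset.powersetCard k (Finset.univ : Finset (Fin m)) := by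
    intro C hC
    obtain ⟨K, hK, hcard, htop⟩ := exists_top_of_mem_flagChains_insert hT hC
    rw [sup_eq_of_top hK htop]
    simp [hcard]
  rw [Finset.card_eq_sum_card_fiberwise hmaps, Finset.sum_const_nat fun K hK =>
    card_flagChains_insert_filter_sup hT (Finset.mem_powersetCard.1 hK).2]
  simp

/-! ### From the flag f-vector to a recursion for the ab-index -/

/-- The monomial obtained from `u_T` by the substitution of `a - b` for `a`. -/
noncomputable def flagMonomial (n : ℕ) (T : Finset ℕ) : FreeAlgebra ℚ ABVar :=
  ((List.range n).map fun i => if i + 1 ∈ T then FreeAlgebra.ι ℚ ABVar.b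
    else FreeAlgebra.ι ℚ ABVar.a - FreeAlgebra.ι ℚ ABVar.b).prod

theorem Finset.Icc_one_succ (n : ℕ) : Finset.Icc 1 (n + 1) = insert (n + 1) (Finset.Icc 1 n) := by
  ext x
  simp only [Finset.mem_Icc, Finset.mem_insert]
  omega

theorem abMonomial_succ (n : ℕ) (S : Finset ℕ) : abMonomial (n + 1) S =
    abMonomial n S * FreeAlgebra.ι ℚ (if n + 1 ∈ S then ABVar.b else ABVar.a) := by
  simp [abMonomial, List.range_succ]

theorem abMonomial_insert (n : ℕ) (S : Finset ℕ) :
    abMonomial n (insert (n + 1) S) = abMonomial n S := by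
  unfold abMonomial
  congr 1
  refine List.map_congr_left fun i hi => ?_
  rw [List.mem_range] at hi
  have : i + 1 ∈ insert (n + 1) S ↔ i + 1 ∈ S := by
    rw [Finset.mem_insert, or_iff_right (by omega)]
  simp only [this]

theorem flagMonomial_succ (n : ℕ) (S : Finset ℕ) : flagMonomial (n + 1) S =
    flagMonomial n S * (if n + 1 ∈ S then FreeAlgebra.ι ℚ ABVar.b
      else FreeAlgebra.ι ℚ ABVar.a - FreeAlgebra.ι ℚ ABVar.b) := by
  simp [flagMonomial, List.range_succ]

theorem flagMonomial_insert (n : ℕ) (S : Finset ℕ) :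
    flagMonomial n (insert (n + 1) S) = flagMonomial n S := by
  unfold flagMonomial
  congr 1
  refine List.map_congr_left fun i hi => ?_
  rw [List.mem_range] at hi
  have : i + 1 ∈ insert (n + 1) S ↔ i + 1 ∈ S := by
    rw [Finset.mem_insert, or_iff_right (by omega)]
  simp only [this]

theorem notMem_of_mem_powerset_Icc {n : ℕ} {S : Finset ℕ} (hS : S ∈ (Finset.Icc 1 n).powerset) :
    n + 1 ∉ S := by
  intro h
  have := Finset.mem_Icc.1 (Finset.mem_powerset.1 hS h)
  omega

theorem sum_flagMonomial_succ (n : ℕ) (f : Finset ℕ → ℚ) :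
    ∑ T ∈ (Finset.Icc 1 (n + 1)).powerset, f T • flagMonomial (n + 1) T =
      (∑ T ∈ (Finset.Icc 1 n).powerset, f T • flagMonomial n T) *
        (FreeAlgebra.ι ℚ ABVar.a - FreeAlgebra.ι ℚ ABVar.b) +
      (∑ T ∈ (Finset.Icc 1 n).powerset, f (insert (n + 1) T) • flagMonomial n T) *
        FreeAlgebra.ι ℚ ABVar.b := by
  rw [Finset.Icc_one_succ, Finset.sum_powerset_insert (by simp), Finset.sum_mul, Finset.sum_mul]
  congr 1
  · refine Finset.sum_congr rfl fun T hT => ?_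
    rw [flagMonomial_succ, if_neg (notMem_of_mem_powerset_Icc hT), smul_mul_assoc]
  · refine Finset.sum_congr rfl fun T hT => ?_
    rw [flagMonomial_succ, if_pos (Finset.mem_insert_self _ _), flagMonomial_insert,
      smul_mul_assoc]

/-- Expanding every factor `a - b` of `flagMonomial n T`, the positions where `-b` is chosen form `S
\ T`, which accounts for the signs. -/
theorem sum_alternating_smul_abMonomial (n : ℕ) (f : Finset ℕ → ℚ) :
    ∑ S ∈ (Finset.Icc 1 n).powerset,
      (∑ T ∈ S.powerset, (-1) ^ (S \ T).card * f T) • abMonomial n S =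
      ∑ T ∈ (Finset.Icc 1 n).powerset, f T • flagMonomial n T := by
  induction n generalizing f with
  | zero => simp [abMonomial, flagMonomial]
  | succ n ih =>
    rw [sum_flagMonomial_succ, ← ih, ← ih, Finset.Icc_one_succ,
      Finset.sum_powerset_insert (by simp), Finset.sum_mul, Finset.sum_mul,
      ← Finset.sum_add_distrib, ← Finset.sum_add_distrib]
    refine Finset.sum_congr rfl fun S hS => ?_
    have hn := notMem_of_mem_powerset_Icc hS
    rw [abMonomial_succ, if_neg hn, abMonomial_succ, if_pos (Finset.mem_insert_self _ _),
      abMonomial_insert, Finset.sum_powerset_insert hn]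
    have h₁ : ∑ T ∈ S.powerset, (-1 : ℚ) ^ (insert (n + 1) S \ T).card * f T =
        - ∑ T ∈ S.powerset, (-1 : ℚ) ^ (S \ T).card * f T := by
      rw [← Finset.sum_neg_distrib]
      refine Finset.sum_congr rfl fun T hT => ?_
      have hT' : n + 1 ∉ T := fun h => hn (Finset.mem_powerset.1 hT h)
      rw [Finset.insert_sdiff_of_notMem _ hT', Finset.card_insert_of_notMem (by simp [hn]),
        pow_succ]
      ring
    have h₂ : ∑ T ∈ S.powerset,
        (-1 : ℚ) ^ (insert (n + 1) S \ insert (n + 1) T).card * f (insert (n + 1) T) =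
        ∑ T ∈ S.powerset, (-1 : ℚ) ^ (S \ T).card * f (insert (n + 1) T) := by
      refine Finset.sum_congr rfl fun T hT => ?_
      rw [Finset.insert_sdiff_insert, Finset.sdiff_insert_of_notMem hn]
    rw [h₁, h₂, add_smul, neg_smul, smul_mul_assoc, smul_mul_assoc, mul_sub, smul_sub]
    abel

theorem abIndex_booleanLattice (m n : ℕ) : abIndex (BooleanLattice m) n =
    ∑ T ∈ (Finset.Icc 1 n).powerset, ((flagChains m T).card : ℚ) • flagMonomial n T := by
  rw [abIndex, ← sum_alternating_smul_abMonomial]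
  refine Finset.sum_congr rfl fun S _ => ?_
  simp [flagH, flagF_booleanLattice]

/-- Group the sets `T` by their largest element `k + 1`: the positions above it contribute powers of
`a - b`, those below an ab-index of a smaller Boolean lattice. Keeping `m` independent of `n` is
what allows induction on `n`. -/
theorem sum_card_flagChains_smul (m n : ℕ) :
    ∑ T ∈ (Finset.Icc 1 n).powerset, ((flagChains m T).card : ℚ) • flagMonomial n T =
      (FreeAlgebra.ι ℚ ABVar.a - FreeAlgebra.ι ℚ ABVar.b) ^ n +
      ∑ k ∈ Finset.range n, (m.choose (k + 1) : ℚ) •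
        (abIndex (BooleanLattice (k + 1)) k * FreeAlgebra.ι ℚ ABVar.b *
          (FreeAlgebra.ι ℚ ABVar.a - FreeAlgebra.ι ℚ ABVar.b) ^ (n - 1 - k)) := by
  induction n with
  | zero => simp [flagMonomial, card_flagChains_empty]
  | succ n ih =>
    rw [sum_flagMonomial_succ, ih, Finset.sum_range_succ, add_mul, ← pow_succ, add_assoc]
    congr 1
    congr 1
    · rw [Finset.sum_mul]
      refine Finset.sum_congr rfl fun k hk => ?_
      rw [Finset.mem_range] at hk
      rw [smul_mul_assoc, mul_assoc _ (_ ^ _), ← pow_succ,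
        show n - 1 - k + 1 = n + 1 - 1 - k by omega]
    · rw [abIndex_booleanLattice, Nat.add_sub_cancel, Nat.sub_self, pow_zero, mul_one,
        ← smul_mul_assoc, Finset.smul_sum]
      congr 1
      refine Finset.sum_congr rfl fun T hT => ?_
      rw [card_flagChains_insert, Nat.cast_mul, mul_smul]
      intro x hx
      have := Finset.mem_Icc.1 (Finset.mem_powerset.1 hT hx)
      omega

theorem abIndex_booleanLattice_rec (n : ℕ) : abIndex (BooleanLattice (n + 1)) n =
    (FreeAlgebra.ι ℚ ABVar.a - FreeAlgebra.ι ℚ ABVar.b) ^ n +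
      ∑ k ∈ Finset.range n, ((n + 1).choose (k + 1) : ℚ) •
        (abIndex (BooleanLattice (k + 1)) k * FreeAlgebra.ι ℚ ABVar.b *
          (FreeAlgebra.ι ℚ ABVar.a - FreeAlgebra.ι ℚ ABVar.b) ^ (n - 1 - k)) := by
  rw [abIndex_booleanLattice, sum_card_flagChains_smul]

/-! ### Exponential generating functions over a noncommutative ring -/

namespace PowerSeries

variable {A : Type*} [Ring A]

/-- The formal derivative of a power series over a possibly noncommutative ring. -/
noncomputable def ncDeriv (f : PowerSeries A) : PowerSeries A :=
  mk fun n => (n + 1) • coeff (n + 1) f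

theorem coeff_ncDeriv (f : PowerSeries A) (n : ℕ) :
    coeff n (ncDeriv f) = (n + 1) • coeff (n + 1) f := coeff_mk _ _

theorem ncDeriv_add (f g : PowerSeries A) : ncDeriv (f + g) = ncDeriv f + ncDeriv g := by
  ext n
  simp [coeff_ncDeriv]

theorem ncDeriv_mul (f g : PowerSeries A) :
    ncDeriv (f * g) = ncDeriv f * g + f * ncDeriv g := by
  ext n
  rw [coeff_ncDeriv, map_add, coeff_mul, coeff_mul, coeff_mul]
  simp only [coeff_ncDeriv]
  have h : (n + 1) • ∑ p ∈ Finset.HasAntidiagonal.antidiagonal (n + 1),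
      coeff p.1 f * coeff p.2 g =
      ∑ p ∈ Finset.HasAntidiagonal.antidiagonal (n + 1), (p.1 • coeff p.1 f) * coeff p.2 g +
      ∑ p ∈ Finset.HasAntidiagonal.antidiagonal (n + 1), coeff p.1 f * (p.2 • coeff p.2 g) := by
    rw [Finset.smul_sum, ← Finset.sum_add_distrib]
    refine Finset.sum_congr rfl fun p hp => ?_
    rw [smul_mul_assoc, mul_smul_comm, ← add_smul, Finset.HasAntidiagonal.mem_antidiagonal.1 hp]
  rw [h, Finset.Nat.sum_antidiagonal_succ, Finset.Nat.sum_antidiagonal_succ']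
  simp

theorem ncDeriv_C (a : A) : ncDeriv (C a) = 0 := by
  ext n
  simp [coeff_ncDeriv]

/-- Since `g` has no constant term, each coefficient of `f * g` involves only earlier coefficients
of `f`. -/
theorem eq_zero_of_eq_mul {f g : PowerSeries A} (hg : coeff 0 g = 0) (h : f = f * g) : f = 0 := by
  ext n
  induction n using Nat.strong_induction_on with
  | _ n ih =>
    rw [h, coeff_mul, map_zero]
    refine Finset.sum_eq_zero fun p hp => ?_
    rw [Finset.HasAntidiagonal.mem_antidiagonal] at hp
    rcases Nat.eq_zero_or_pos p.2 with h₂ | h₂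
    · rw [h₂, hg, mul_zero]
    · rw [ih p.1 (by omega), map_zero, zero_mul]

/-- The Riccati equation for `f = g + f b g`, where `g = (exp ((a - b) x) - 1) / (a - b)`. -/
theorem two_smul_ncDeriv_eq {f g : PowerSeries A} {a b : A} (hg : coeff 0 g = 0)
    (hf : f = g + f * C b * g) (h₁ : ncDeriv g = 1 + (C a - C b) * g)
    (h₂ : ncDeriv g = 1 + g * (C a - C b)) :
    ncDeriv f + ncDeriv f = 2 + (C a + C b) * f + f * (C a + C b) +
      f * (C a * C b + C b * C a) * f := by
  have hD : ncDeriv f = ncDeriv g + ncDeriv f * C b * g + f * C b * ncDeriv g := by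
    conv_lhs => rw [hf]
    rw [ncDeriv_add, ncDeriv_mul, ncDeriv_mul, ncDeriv_C, mul_zero, add_zero, add_assoc]
  have hbg : coeff 0 (C b * g) = 0 := by rw [coeff_C_mul, hg, mul_zero]
  -- Two factorizations of `f'`, one from each form of `g'`. In both, the difference `D` of the two
  -- sides satisfies `D = D b g`, hence vanishes; their sum is symmetric in `a` and `b`, which
  -- produces `c` and `d`.
  have e₁ : ncDeriv f - (1 + f * C b) * (1 + C a * f) = 0 := by
    apply eq_zero_of_eq_mul hbg
    linear_combination (norm := noncomm_ring)
      hD + (1 + f * C b) * h₁ - (1 + f * C b) * C a * hf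
  have e₂ : ncDeriv f - (1 + f * C a) * (1 + C b * f) = 0 := by
    apply eq_zero_of_eq_mul hbg
    linear_combination (norm := noncomm_ring)
      hD + (1 + f * C b) * h₂ - (1 + f * C a) * C b * hf - hf * (C a - C b)
  rw [← one_add_one_eq_two]
  linear_combination (norm := noncomm_ring) e₁ + e₂

end PowerSeries

/-! ### The **cd**-index of the Boolean lattice -/

/-- The exponential generating function of the **ab**-indices of the Boolean lattices. -/
noncomputable def abSeries : PowerSeries (FreeAlgebra ℚ ABVar) :=
  PowerSeries.mk fun
    | 0 => 0
    | n + 1 => ((n + 1).factorial : ℚ)⁻¹ • abIndex (BooleanLattice (n + 1)) n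

/-- The power series `(exp ((a - b) x) - 1) / (a - b)`. -/
noncomputable def expSubOneSeries : PowerSeries (FreeAlgebra ℚ ABVar) :=
  PowerSeries.mk fun
    | 0 => 0
    | n + 1 => ((n + 1).factorial : ℚ)⁻¹ •
        (FreeAlgebra.ι ℚ ABVar.a - FreeAlgebra.ι ℚ ABVar.b) ^ n

section AbSeries

open PowerSeries

theorem coeff_zero_abSeries : coeff 0 abSeries = 0 := by
  rw [abSeries, coeff_mk]

theorem coeff_succ_abSeries (n : ℕ) : coeff (n + 1) abSeries =
    ((n + 1).factorial : ℚ)⁻¹ • abIndex (BooleanLattice (n + 1)) n := by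
  rw [abSeries, coeff_mk]

theorem coeff_zero_expSubOneSeries : coeff 0 expSubOneSeries = 0 := by
  rw [expSubOneSeries, coeff_mk]

theorem coeff_succ_expSubOneSeries (n : ℕ) : coeff (n + 1) expSubOneSeries =
    ((n + 1).factorial : ℚ)⁻¹ • (FreeAlgebra.ι ℚ ABVar.a - FreeAlgebra.ι ℚ ABVar.b) ^ n := by
  rw [expSubOneSeries, coeff_mk]

/-- The generating-function form of `abIndex_booleanLattice_rec`; the binomial coefficients are
absorbed by the factorials. -/
theorem abSeries_eq :
    abSeries = expSubOneSeries + abSeries * C (FreeAlgebra.ι ℚ ABVar.b) * expSubOneSeries := by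
  ext n
  rcases n with _ | n
  · rw [map_add, coeff_mul, Finset.HasAntidiagonal.antidiagonal_zero, Finset.sum_singleton,
      coeff_zero_abSeries, coeff_zero_expSubOneSeries, mul_zero, add_zero]
  · rw [map_add, coeff_mul, Finset.Nat.sum_antidiagonal_succ]
    simp only [coeff_mul_C, coeff_zero_abSeries, zero_mul, zero_add]
    rw [Finset.Nat.sum_antidiagonal_eq_sum_range_succ (fun i j =>
      coeff (i + 1) abSeries * FreeAlgebra.ι ℚ ABVar.b * coeff j expSubOneSeries),
      Finset.sum_range_succ, Nat.sub_self, coeff_zero_expSubOneSeries, mul_zero, add_zero,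
      coeff_succ_abSeries, abIndex_booleanLattice_rec, smul_add, coeff_succ_expSubOneSeries,
      Finset.smul_sum]
    congr 1
    refine Finset.sum_congr rfl fun k hk => ?_
    rw [Finset.mem_range] at hk
    rw [show n - k = n - 1 - k + 1 by omega, coeff_succ_abSeries, coeff_succ_expSubOneSeries,
      smul_smul, smul_mul_assoc, smul_mul_assoc, mul_smul_comm, smul_smul]
    congr 1
    rw [show n - 1 - k + 1 = n + 1 - (k + 1) by omega, Nat.cast_choose ℚ (by omega)]
    have := Nat.factorial_ne_zero (n + 1)
    field_simp

theorem ncDeriv_expSubOneSeries (n : ℕ) : coeff n (ncDeriv expSubOneSeries) =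
    (n.factorial : ℚ)⁻¹ • (FreeAlgebra.ι ℚ ABVar.a - FreeAlgebra.ι ℚ ABVar.b) ^ n := by
  rw [coeff_ncDeriv, coeff_succ_expSubOneSeries, ← Nat.cast_smul_eq_nsmul ℚ, smul_smul,
    Nat.factorial_succ]
  congr 1
  push_cast
  have := Nat.factorial_ne_zero n
  field_simp

theorem ncDeriv_expSubOneSeries_eq_left : ncDeriv expSubOneSeries =
    1 + (C (FreeAlgebra.ι ℚ ABVar.a) - C (FreeAlgebra.ι ℚ ABVar.b)) * expSubOneSeries := by
  ext n
  rw [ncDeriv_expSubOneSeries, ← map_sub, map_add, coeff_C_mul, coeff_one]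
  rcases n with _ | n
  · simp [coeff_zero_expSubOneSeries]
  · rw [coeff_succ_expSubOneSeries, mul_smul_comm, ← pow_succ', if_neg (by omega), zero_add]

theorem ncDeriv_expSubOneSeries_eq_right : ncDeriv expSubOneSeries =
    1 + expSubOneSeries * (C (FreeAlgebra.ι ℚ ABVar.a) - C (FreeAlgebra.ι ℚ ABVar.b)) := by
  ext n
  rw [ncDeriv_expSubOneSeries, ← map_sub, map_add, coeff_mul_C, coeff_one]
  rcases n with _ | n
  · simp [coeff_zero_expSubOneSeries]
  · rw [coeff_succ_expSubOneSeries, smul_mul_assoc, ← pow_succ, if_neg (by omega), zero_add]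

theorem coeff_abSeries_rec (n : ℕ) : (2 * (n + 1) : ℚ) • coeff (n + 1) abSeries =
    (if n = 0 then (2 : ℚ) • 1 else 0) + cdToAb (FreeAlgebra.ι ℚ CDVar.c) * coeff n abSeries +
      coeff n abSeries * cdToAb (FreeAlgebra.ι ℚ CDVar.c) +
      ∑ p ∈ Finset.HasAntidiagonal.antidiagonal n,
        coeff p.1 abSeries * cdToAb (FreeAlgebra.ι ℚ CDVar.d) * coeff p.2 abSeries := by
  have h := congrArg (coeff n) (two_smul_ncDeriv_eq coeff_zero_expSubOneSeries abSeries_eq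
    ncDeriv_expSubOneSeries_eq_left ncDeriv_expSubOneSeries_eq_right)
  rw [← one_add_one_eq_two] at h
  simp only [← map_mul, ← map_add C] at h
  simp only [map_add (coeff n), coeff_ncDeriv, coeff_one] at h
  rw [coeff_C_mul, coeff_mul_C, coeff_mul] at h
  simp only [coeff_mul_C] at h
  rw [cdToAb_c, cdToAb_d, mul_smul, two_smul]
  rw [← Nat.cast_smul_eq_nsmul ℚ] at h
  push_cast at h
  rw [h]
  congr 3
  split_ifs
  · rw [two_smul]
  · rw [add_zero]

/-- Both sides satisfy the same recursion, which determines its solution. -/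
theorem cdToAb_booleanCD (n : ℕ) : cdToAb (booleanCD n) = coeff n abSeries := by
  induction n using Nat.strong_induction_on with
  | _ n ih =>
    rcases n with _ | n
    · rw [booleanCD_zero, map_zero, coeff_zero_abSeries]
    · have h := congrArg cdToAb (booleanCD_succ n)
      have hpos : (2 * (n + 1) : ℚ) ≠ 0 := by positivity
      apply smul_right_injective _ hpos
      change (2 * (n + 1) : ℚ) • cdToAb (booleanCD (n + 1)) =
        (2 * (n + 1) : ℚ) • coeff (n + 1) abSeries
      rw [← map_smul, h, coeff_abSeries_rec]
      simp only [map_add, map_mul, map_sum]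
      rw [ih n (by omega)]
      congr 1
      · congr 2
        split_ifs <;> simp
      · refine Finset.sum_congr rfl fun p hp => ?_
        rw [Finset.HasAntidiagonal.mem_antidiagonal] at hp
        rw [ih p.1 (by omega), ih p.2 (by omega)]

theorem cdIndex_booleanLattice (n : ℕ) :
    cdIndex (BooleanLattice (n + 1)) n = ((n + 1).factorial : ℚ) • booleanCD (n + 1) := by
  apply cdIndex_eq_of_cdToAb_eq
  have := Nat.factorial_ne_zero (n + 1)
  rw [map_smul, cdToAb_booleanCD, coeff_succ_abSeries, smul_smul, mul_inv_cancel₀ (by positivity),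
    one_smul]

theorem betaMonomial_eq (v : FreeMonoid CDVar) :
    betaMonomial v = ((wordDegree v.toList + 1).factorial : ℚ) * gammaWord v.toList := by
  rw [betaMonomial, cdIndex_booleanLattice, cdCoeff_eq_wordCoeff, map_smul]
  rfl

end AbSeries

/-! ### List notation and the final comparison -/

theorem toList_of_pow {X : Type*} (x : X) (n : ℕ) :
    (FreeMonoid.of x ^ n).toList = List.replicate n x := by
  induction n with
  | zero => rfl
  | succ n ih => rw [pow_succ', FreeMonoid.toList_mul, ih]; rfl

theorem cdMonomial_replicate_zero (m j : ℕ) : cdMonomial m (List.replicate j 0) =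
    FreeMonoid.of CDVar.c ^ m * FreeMonoid.of CDVar.d ^ j := by
  induction j generalizing m with
  | zero => simp [cdMonomial]
  | succ j ih => rw [List.replicate_succ, cdMonomial, ih, pow_zero, one_mul, pow_succ', mul_assoc]

theorem cdMonomial_replicate_zero_append (t i : ℕ) (L : List ℕ) :
    cdMonomial 0 (List.replicate i 0 ++ t :: L) =
      FreeMonoid.of CDVar.d ^ (i + 1) * cdMonomial t L := by
  induction i with
  | zero => simp [cdMonomial]
  | succ i ih =>
    rw [List.replicate_succ, List.cons_append, cdMonomial, ih, pow_zero, one_mul, pow_succ' _ (i + 1),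
      mul_assoc]

theorem betaList_zeroList_eq_betaMonomial (i t j : ℕ) : betaList (zeroList i t j) =
    betaMonomial (FreeMonoid.of CDVar.d ^ i * (FreeMonoid.of CDVar.c ^ t *
      FreeMonoid.of CDVar.d ^ j)) := by
  -- The head of the list is `t` when `i = 0` and `0` otherwise.
  rcases i with _ | i
  · simp [zeroList, betaList, cdMonomial_replicate_zero]
  · simp only [zeroList, betaList, List.replicate_succ, List.cons_append,
      cdMonomial_replicate_zero_append, cdMonomial_replicate_zero]

theorem betaList_zeroList (i t j : ℕ) : betaList (zeroList i t j) =
    ((2 * (i + j) + t + 1).factorial : ℚ) *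
      gammaWord (List.replicate i .d ++ List.replicate t .c ++ List.replicate j .d) := by
  have ht : wordDegree (List.replicate t .c) = t := by simp [wordDegree, cdDegree]
  rw [betaList_zeroList_eq_betaMonomial, betaMonomial_eq, FreeMonoid.toList_mul,
    FreeMonoid.toList_mul, toList_of_pow, toList_of_pow, toList_of_pow, ← List.append_assoc,
    wordDegree_append, wordDegree_append, wordDegree_replicate_d, wordDegree_replicate_d, ht]
  congr 3
  ring

theorem betaList_zeroList_one (i j : ℕ) : betaList (zeroList i 1 j) =
    ((2 * (i + j) + 2).factorial : ℚ) * (gammaD i * gammaD j / 2) := by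
  rw [betaList_zeroList]
  exact congrArg _ (gammaWord_d_c_d i j)

theorem betaList_zeroList_two (i j : ℕ) : betaList (zeroList i 2 j) =
    ((2 * (i + j) + 3).factorial : ℚ) * (gammaD i * gammaD j / 4 - gammaD (i + j + 1) / 2) := by
  rw [betaList_zeroList]
  exact congrArg _ (gammaWord_d_c_c_d i j)

theorem betaList_zeroList_comm {t : ℕ} (ht : t = 1 ∨ t = 2) (i j : ℕ) :
    betaList (zeroList i t j) = betaList (zeroList j t i) := by
  rcases ht with rfl | rfl
  · rw [betaList_zeroList_one, betaList_zeroList_one, add_comm i j, mul_comm (gammaD i)]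
  · rw [betaList_zeroList_two, betaList_zeroList_two, add_comm i j, mul_comm (gammaD i)]

/-- For fixed `i + j` the factorial and the correction term for `t = 2` are constant, so only the
product `γ_i γ_j` matters. -/
theorem betaList_zeroList_lt {t : ℕ} (ht : t = 1 ∨ t = 2) {i j l m : ℕ} (hil : i < l)
    (hlm : l ≤ m) (h : i + j = l + m) :
    betaList (zeroList l t m) < betaList (zeroList i t j) := by
  have key := gammaD_mul_lt hil hlm h
  rcases ht with rfl | rfl
  · rw [betaList_zeroList_one, betaList_zeroList_one, h]
    exact mul_lt_mul_of_pos_left (by linarith) (by exact_mod_cast Nat.factorial_pos _)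
  · rw [betaList_zeroList_two, betaList_zeroList_two, h]
    exact mul_lt_mul_of_pos_left (by linarith) (by exact_mod_cast Nat.factorial_pos _)

theorem propositionp (t : ℕ) (ht : t = 1 ∨ t = 2) (n : ℕ) :
    StrictAntiOn (fun i => betaList (zeroList i t (n - i))) (Set.Icc 0 (n / 2)) ∧
    betaList (zeroList (n / 2) t (n - n / 2)) =
      betaList (zeroList ((n + 1) / 2) t (n - (n + 1) / 2)) ∧
    StrictMonoOn (fun i => betaList (zeroList i t (n - i))) (Set.Icc ((n + 1) / 2) n) ∧
    ∀ i j l m : ℕ, i + j = n → l + m = n → |(l : ℤ) - m| < |(i : ℤ) - j| →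
      betaList (zeroList l t m) < betaList (zeroList i t j) := by
  refine ⟨?_, ?_, ?_, ?_⟩
  · rintro i - l ⟨-, hl⟩ hil
    exact betaList_zeroList_lt ht hil (by omega) (by omega)
  · rw [betaList_zeroList_comm ht, show n - n / 2 = (n + 1) / 2 by omega,
      show n - (n + 1) / 2 = n / 2 by omega]
  · rintro i ⟨hi, -⟩ l ⟨-, hl⟩ hil
    change betaList (zeroList i t (n - i)) < betaList (zeroList l t (n - l))
    rw [betaList_zeroList_comm ht i, betaList_zeroList_comm ht l]
    exact betaList_zeroList_lt ht (by omega) (by omega) (by omega)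
  · intro i j l m hij hlm h
    wlog hij' : i ≤ j generalizing i j
    · rw [betaList_zeroList_comm ht i]
      exact this j i (by omega) (by rwa [abs_sub_comm (j : ℤ)]) (by omega)
    wlog hlm' : l ≤ m generalizing l m
    · rw [betaList_zeroList_comm ht l]
      exact this m l (by omega) (by rwa [abs_sub_comm (m : ℤ)]) (by omega)
    rw [abs_of_nonpos (by omega), abs_of_nonpos (by omega)] at h
    exact betaList_zeroList_lt ht (by omega) hlm' (by omega)
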